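/- **Proposition 2.1.** Let $(M,g)$ be a smooth oriented four-dimensional Riemannian manifold and let $f\in C^\infty(M)$ satisfy $\mathrm{Ric}+\nabla^2 f=\lambda g$ for some $\lambda\in\mathbb R$ (a gradient Ricci soliton). The curvature tensor is normalized so that $R_{ijij}$ is the sectional curvature of an orthonormal pair $e_i,e_j$, and $R_{ik}=g^{jl}R_{ijkl}$, $R=g^{ij}R_{ij}$. The Weyl tensor is $$W_{ijkl}=R_{ijkl}-\tfrac12\left(R_{ik}g_{jl}+R_{jl}g_{ik}-R_{il}g_{jk}-R_{jk}g_{il}\right)+\tfrac R6\left(g_{ik}g_{jl}-g_{il}g_{jk}\right).$$ Its self-dual and anti-self-dual parts are the tensors $W^\pm$ which in positively oriented orthonormal frames are given by $$W^\pm_{ijkl}=\tfrac14\left(W_{ijkl}\pm W_{ijk'l'}\pm W_{i'j'kl}+W_{i'j'k'l'}\right),$$ where for $i\ne j$ the pair $(i'j')$ is such that $(i,j,i',j')$ is an even permutation of $(1,2,3,4)$. Fix one of the two signs $\pm$ and assume that $\delta W^\pm=0$ on $M$ for this sign, where $(\delta W^\pm)_{jkl}=\nabla^iW^\pm_{ijkl}$.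 Let $p\in M$ be a point with $\nabla f(p)\neq 0$. Then $T_pM$ has an orthonormal basis $e_1=\frac{\nabla f}{|\nabla f|},e_2,e_3,e_4$ of eigenvectors of the traceless Ricci tensor $\mathrm{Ric}-\frac R4g$. For every such basis, with corresponding eigenvalues $a_1,a_2,a_3,a_4$, and for the same sign, $$\begin{aligned} W^\pm_{1212}&=-\tfrac1{12}(a_1+3a_2)=\tfrac1{12}(a_3+a_4-2a_2),\\ W^\pm_{1313}&=-\tfrac1{12}(a_1+3a_3)=\tfrac1{12}(a_2+a_4-2a_3),\\ W^\pm_{1414}&=-\tfrac1{12}(a_1+3a_4)=\tfrac1{12}(a_2+a_3-2a_4),\\ W^\pm_{1j1l}&=0\quad\text{if } j\neq l . \end{aligned}$$ -/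

import Mathlib

open Set Filter Topology
open scoped Manifold ContDiff Bundle

noncomputable section

namespace HalfWeyl

/-- The model space of four-manifolds. -/
abbrev E4 : Type := EuclideanSpace ℝ (Fin 4)

/-! ### Tensor calculus in one coordinate system

`G : E4 → Matrix (Fin 4) (Fin 4) ℝ` is the matrix of components `g_{ij}` of a metric as a function
of the coordinates; `(G y)⁻¹` is the matrix of the `g^{ij}`. -/

/-- A field of `(0,4)`-tensor components. -/
abbrev Tensor4 : Type := E4 → Fin 4 → Fin 4 → Fin 4 → Fin 4 → ℝ

/-- The coordinate derivative `∂ᵢ F`. -/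
def pd (i : Fin 4) (F : E4 → ℝ) (y : E4) : ℝ :=
  fderiv ℝ F y (EuclideanSpace.single i 1)

/-- The Christoffel symbols `Γ^k_{ij}` of the Levi-Civita connection,
`∇_{∂ᵢ} ∂ⱼ = Γ^k_{ij} ∂ₖ`. -/
def christoffel (G : E4 → Matrix (Fin 4) (Fin 4) ℝ) (k i j : Fin 4) (y : E4) : ℝ :=
  (1 / 2) * ∑ l, (G y)⁻¹ k l *
    (pd i (fun z => G z j l) y + pd j (fun z => G z i l) y - pd l (fun z => G z i j) y)

/-- `R^h_{ijl}`, the `h`-th component of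
`∇_{∂ᵢ} ∇_{∂ⱼ} ∂ₗ - ∇_{∂ⱼ} ∇_{∂ᵢ} ∂ₗ`. -/
def riemannUp (G : E4 → Matrix (Fin 4) (Fin 4) ℝ) (h i j l : Fin 4) (y : E4) : ℝ :=
  pd i (christoffel G h j l) y - pd j (christoffel G h i l) y
    + ∑ m, (christoffel G h i m y * christoffel G m j l y
      - christoffel G h j m y * christoffel G m i l y)

/-- `R_{ijkl} = g_{hk} R^h_{ijl}`; the sectional curvature of an orthonormal pair is `R_{ijij}`. -/
def riemann (G : E4 → Matrix (Fin 4) (Fin 4) ℝ) : Tensor4 := fun y i j k l =>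
  ∑ h, G y h k * riemannUp G h i j l y

/-- `R_{ik} = g^{jl} R_{ijkl}`. -/
def ricci (G : E4 → Matrix (Fin 4) (Fin 4) ℝ) (y : E4) (i k : Fin 4) : ℝ :=
  ∑ j, ∑ l, (G y)⁻¹ j l * riemann G y i j k l

/-- The scalar curvature `R = g^{ij} R_{ij}`. -/
def scalar (G : E4 → Matrix (Fin 4) (Fin 4) ℝ) (y : E4) : ℝ :=
  ∑ i, ∑ j, (G y)⁻¹ i j * ricci G y i j

/-- The traceless Ricci tensor `R_{ij} - (R/4) g_{ij}`. -/
def tracelessRicci (G : E4 → Matrix (Fin 4) (Fin 4) ℝ) (y : E4) (i j : Fin 4) : ℝ :=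
  ricci G y i j - scalar G y / 4 * G y i j

/-- The Weyl tensor in dimension four. -/
def weyl (G : E4 → Matrix (Fin 4) (Fin 4) ℝ) : Tensor4 := fun y i j k l =>
  riemann G y i j k l
    - (1 / 2) * (ricci G y i k * G y j l + ricci G y j l * G y i k
        - ricci G y i l * G y j k - ricci G y j k * G y i l)
    + scalar G y / 6 * (G y i k * G y j l - G y i l * G y j k)

/-- The Hessian `∇ᵢ∇ⱼ F = ∂ᵢ∂ⱼ F - Γ^k_{ij} ∂ₖ F`. -/
def hessian (G : E4 → Matrix (Fin 4) (Fin 4) ℝ) (F : E4 → ℝ) (y : E4) (i j : Fin 4) : ℝ :=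
  pd i (pd j F) y - ∑ k, christoffel G k i j y * pd k F y

/-- The covariant derivative `∇ₘ T_{ijkl}` of a `(0,4)`-tensor field. -/
def covDeriv (G : E4 → Matrix (Fin 4) (Fin 4) ℝ) (T : Tensor4) (y : E4) (m i j k l : Fin 4) : ℝ :=
  pd m (fun z => T z i j k l) y
    - ∑ a, (christoffel G a m i y * T y a j k l + christoffel G a m j y * T y i a k l
        + christoffel G a m k y * T y i j a l + christoffel G a m l y * T y i j k a)

/-- The divergence `(δT)_{jkl} = ∇^i T_{ijkl}`. -/
def divergence (G : E4 → Matrix (Fin 4) (Fin 4) ℝ) (T : Tensor4) (y : E4) (j k l : Fin 4) : ℝ :=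
  ∑ m, ∑ i, (G y)⁻¹ m i * covDeriv G T y m i j k l

/-- The Levi-Civita symbol: the determinant of the matrix whose rows are the standard basis vectors
number `i, j, k, l`. -/
def leviCivitaSymbol (i j k l : Fin 4) : ℝ :=
  (Matrix.of fun a b : Fin 4 => if ![i, j, k, l] a = b then (1 : ℝ) else 0).det

/-- The components of the Riemannian volume form; `s` is `1` where the coordinates are positively
oriented and `-1` where they are negatively oriented. -/
def volumeForm (G : E4 → Matrix (Fin 4) (Fin 4) ℝ) (s : E4 → ℝ) : Tensor4 := fun y i j k l =>
  s y * Real.sqrt (G y).det * leviCivitaSymbol i j k l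

/-- The Hodge star on the first pair of indices,
`(⋆T)_{ijkl} = ½ vol_{ijcd} g^{ca} g^{db} T_{abkl}`. In a positively oriented orthonormal frame this
is `T_{i'j'kl}`, where `(i, j, i', j')` is an even permutation of `(1, 2, 3, 4)`. -/
def starLeft (G : E4 → Matrix (Fin 4) (Fin 4) ℝ) (s : E4 → ℝ) (T : Tensor4) : Tensor4 :=
  fun y i j k l => (1 / 2) * ∑ a, ∑ b, ∑ c, ∑ d,
    volumeForm G s y i j c d * (G y)⁻¹ c a * (G y)⁻¹ d b * T y a b k l

/-- The Hodge star on the second pair of indices; in a positively oriented orthonormal frame this is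
`T_{ijk'l'}`. -/
def starRight (G : E4 → Matrix (Fin 4) (Fin 4) ℝ) (s : E4 → ℝ) (T : Tensor4) : Tensor4 :=
  fun y i j k l => (1 / 2) * ∑ a, ∑ b, ∑ c, ∑ d,
    volumeForm G s y k l c d * (G y)⁻¹ c a * (G y)⁻¹ d b * T y i j a b

/-- The self-dual (`ε = 1`) or anti-self-dual (`ε = -1`) part
`T^± = ¼ (T_{ijkl} ± T_{ijk'l'} ± T_{i'j'kl} + T_{i'j'k'l'})`. -/
def dualPart (G : E4 → Matrix (Fin 4) (Fin 4) ℝ) (s : E4 → ℝ) (ε : ℤˣ) (T : Tensor4) : Tensor4 :=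
  fun y i j k l => (1 / 4) * (T y i j k l + ((ε : ℤ) : ℝ) * starRight G s T y i j k l
    + ((ε : ℤ) : ℝ) * starLeft G s T y i j k l + starLeft G s (starRight G s T) y i j k l)

/-! ### Riemannian four-manifolds -/

variable {M : Type*} [TopologicalSpace M] [ChartedSpace E4 M]

/-- The coordinate frame `∂₁, …, ∂₄` of the chart `φ` at the point with coordinates `y`. -/
def coordFrame (φ : OpenPartialHomeomorph M E4) (y : E4) (i : Fin 4) :
    TangentSpace (𝓡 4) (φ.symm y) :=
  mfderiv (𝓡 4) (𝓡 4) φ.symm y (EuclideanSpace.single i (1 : ℝ) : E4)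

/-- The components of a tangent vector at `p` in the chart `φ`. -/
def coords (φ : OpenPartialHomeomorph M E4) (p : M) (v : TangentSpace (𝓡 4) p) : E4 :=
  mfderiv (𝓡 4) (𝓡 4) φ p v

/-- A smooth Riemannian metric on a four-manifold. -/
abbrev Metric4 (M : Type*) [TopologicalSpace M] [ChartedSpace E4 M] [IsManifold (𝓡 4) ∞ M] :
    Type _ :=
  Bundle.ContMDiffRiemannianMetric (𝓡 4) ∞ E4 (fun x : M => TangentSpace (𝓡 4) x)

/-- `v` is a basis of `V` with orientation `o`. -/
def IsPositiveFrame {V : Type*} [AddCommGroup V] [Module ℝ V] (o : Orientation ℝ V (Fin 4))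
    (v : Fin 4 → V) : Prop :=
  ∃ b : Module.Basis (Fin 4) ℝ V, (∀ i, b i = v i) ∧ b.orientation = o

/-- An orientation of a four-manifold: orientations of all the tangent spaces such that the
orientation of the coordinate frame of every chart is locally constant. -/
structure ManifoldOrientation (M : Type*) [TopologicalSpace M] [ChartedSpace E4 M] where
  toFun : ∀ p : M, Orientation ℝ (TangentSpace (𝓡 4) p) (Fin 4)
  locallyConstant : ∀ φ ∈ atlas E4 M, ∀ y ∈ φ.target, ∀ᶠ z in 𝓝 y,
    (IsPositiveFrame (toFun (φ.symm z)) (coordFrame φ z) ↔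
      IsPositiveFrame (toFun (φ.symm y)) (coordFrame φ y))

open Classical in
/-- `1` where the chart `φ` is positively oriented, `-1` where it is negatively oriented. -/
def chartSign (o : ManifoldOrientation M) (φ : OpenPartialHomeomorph M E4) (y : E4) : ℝ :=
  if IsPositiveFrame (o.toFun (φ.symm y)) (coordFrame φ y) then 1 else -1

variable [IsManifold (𝓡 4) ∞ M]

/-- The components `g_{ij}` of the metric in the chart `φ`. -/
def metricComponents (g : Metric4 M) (φ : OpenPartialHomeomorph M E4) (y : E4) :
    Matrix (Fin 4) (Fin 4) ℝ :=
  Matrix.of fun i j => g.inner (φ.symm y) (coordFrame φ y i) (coordFrame φ y j)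

/-- The components `W^±_{ijkl}` of the (anti-)self-dual Weyl tensor in the chart `φ`. -/
def halfWeyl (g : Metric4 M) (o : ManifoldOrientation M) (ε : ℤˣ)
    (φ : OpenPartialHomeomorph M E4) : Tensor4 :=
  dualPart (metricComponents g φ) (chartSign o φ) ε (weyl (metricComponents g φ))

/-- The value of `W^±` on four tangent vectors at `p`, computed in the chart `φ`. -/
def halfWeylAt (g : Metric4 M) (o : ManifoldOrientation M) (ε : ℤˣ)
    (φ : OpenPartialHomeomorph M E4) (p : M) (u v w z : TangentSpace (𝓡 4) p) : ℝ :=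
  ∑ i, ∑ j, ∑ k, ∑ l, halfWeyl g o ε φ (φ p) i j k l *
    coords φ p u i * coords φ p v j * coords φ p w k * coords φ p z l

/-- The value of the traceless Ricci tensor on two tangent vectors at `p`, computed in the
chart `φ`. -/
def tracelessRicciAt (g : Metric4 M) (φ : OpenPartialHomeomorph M E4) (p : M)
    (u v : TangentSpace (𝓡 4) p) : ℝ :=
  ∑ i, ∑ j, tracelessRicci (metricComponents g φ) (φ p) i j * coords φ p u i * coords φ p v j

/-- `(M, g, f)` is a gradient Ricci soliton: `f` is smooth and `Ric + ∇²f = λ g` for a real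
constant `λ`. The tensor equation is written out in components in every chart of the atlas. -/
def IsGradientRicciSoliton (g : Metric4 M) (f : M → ℝ) : Prop :=
  ContMDiff (𝓡 4) 𝓘(ℝ) ∞ f ∧ ∃ lam : ℝ, ∀ φ ∈ atlas E4 M, ∀ y ∈ φ.target, ∀ i j,
    ricci (metricComponents g φ) y i j + hessian (metricComponents g φ) (f ∘ φ.symm) y i j
      = lam * metricComponents g φ y i j

/-- `δW^± = 0` on `M`. The tensor equation is written out in components in every chart of the
atlas. -/
def IsHalfWeylHarmonic (g : Metric4 M) (o : ManifoldOrientation M) (ε : ℤˣ) : Prop :=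
  ∀ φ ∈ atlas E4 M, ∀ y ∈ φ.target, ∀ j k l,
    divergence (metricComponents g φ) (halfWeyl g o ε φ) y j k l = 0

theorem exists_gradient (g : Metric4 M) (f : M → ℝ) (p : M) :
    ∃ v : TangentSpace (𝓡 4) p, ∀ u : TangentSpace (𝓡 4) p,
      g.inner p v u = mfderiv (𝓡 4) 𝓘(ℝ) f p u := by
  let L : TangentSpace (𝓡 4) p →ₗ[ℝ] Module.Dual ℝ (TangentSpace (𝓡 4) p) :=
    { toFun := fun v => (g.inner p v).toLinearMap
      map_add' := fun v w => by ext u; simp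
      map_smul' := fun c v => by ext u; simp }
  have hinj : Function.Injective L := by
    refine (injective_iff_map_eq_zero L).2 fun v hv => ?_
    by_contra hne
    have h0 : g.inner p v v = 0 := LinearMap.congr_fun hv v
    exact absurd h0 (g.pos p v hne).ne'
  have : FiniteDimensional ℝ (TangentSpace (𝓡 4) p) := inferInstanceAs (FiniteDimensional ℝ E4)
  obtain ⟨v, hv⟩ := (LinearMap.injective_iff_surjective_of_finrank_eq_finrank
    (Subspace.dual_finrank_eq (K := ℝ) (V := TangentSpace (𝓡 4) p)).symm).1 hinj
    (mfderiv (𝓡 4) 𝓘(ℝ) f p).toLinearMap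
  exact ⟨v, fun u => LinearMap.congr_fun hv u⟩

/-- The gradient `∇f` at `p`: the vector with `g(∇f, u) = df(u)` for all `u`. -/
def grad (g : Metric4 M) (f : M → ℝ) (p : M) : TangentSpace (𝓡 4) p :=
  (exists_gradient g f p).choose

/-- `|∇f|` at `p`. -/
def gradientNorm (g : Metric4 M) (f : M → ℝ) (p : M) : ℝ :=
  Real.sqrt (g.inner p (grad g f p) (grad g f p))

/-- `e` is an orthonormal basis of the tangent space at `p` whose first vector is `∇f/|∇f|` and
which consists of eigenvectors of the traceless Ricci tensor, with eigenvalues `a`. -/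
structure IsAdaptedEigenbasis (g : Metric4 M) (f : M → ℝ) (φ : OpenPartialHomeomorph M E4) (p : M)
    (e : Fin 4 → TangentSpace (𝓡 4) p) (a : Fin 4 → ℝ) : Prop where
  orthonormal : ∀ i j, g.inner p (e i) (e j) = if i = j then 1 else 0
  first : e 0 = (gradientNorm g f p)⁻¹ • grad g f p
  eigen : ∀ i (u : TangentSpace (𝓡 4) p), tracelessRicciAt g φ p (e i) u = a i * g.inner p (e i) u

end HalfWeyl

end

open HalfWeyl

/-!
On a gradient Ricci soliton the divergence of the Weyl tensor contains no derivatives of the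
curvature. The second Bianchi identity gives `δW` as the Codazzi defect `∇ᵢR_{jk} - ∇ⱼR_{ik}` up to
terms in `dR`; the soliton equation and the Ricci identity turn the defect into `R_{ijak} ∇ᵃf`, and
one more trace turns `dR` into `2 Ric(∇f, ·)`. The result is `IsMetricOn.divergence_weyl_of_soliton`:
`δW` at a point is linear in the curvature and in `∇f` there.

The Hodge star is parallel (`IsMetricOn.pdMat_starMat`), because the Levi-Civita symbol transforms
by the determinant and `∂ₘ √det g = tr Γₘ √det g`. In dimension four the trace-free algebraic
curvature tensor `W` commutes with `⋆` (`hodgeDual_comm`), so that `W^± = ½ (W ± W⋆)` and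
`δW^± = ½ (δW ± (δW)⋆)`. In an orthonormal frame that starts with `e₁ = ∇f/|∇f|` the hypothesis
`δW^± = 0` thus becomes a system of linear equations for the curvature at the point
(`IsMetricOn.flatDivergence_add_hodgeDual`).

The rest is linear algebra. The equations whose first index is `1` say that `Ric(∇f) ∧ ∇f` has no
(anti-)self-dual part; a simple two-form with this property vanishes, so `∇f` is an eigenvector of
`Ric` (`flatRicci_zero_of_divergence`), and its orthogonal complement has an orthonormal eigenbasis
(`exists_frame_diagonalizing`). In such a basis the remaining equations are solved for `W^±_{1j1l}`
(`flatWeyl_half_of_divergence`). The sign enters only as a factor `τ = ±1`, the product of `ε` with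
the orientation of the frame, and the values do not depend on it; so the frame need not be
positively oriented.

Coordinate formulas are handled as identities of matrices of functions: the connection matrices
`connMat`, the curvature matrices `curvMat`, and four-index tensors as matrices indexed by pairs of
indices (`pairMat`), on which the Hodge star acts by multiplication with `starMat`.
-/

noncomputable section

namespace HalfWeyl

open Matrix
open scoped Kronecker

/-! ### Coordinate derivatives of functions and of matrices of functions -/

section

theorem pd_congr {F F' : E4 → ℝ} {y : E4} (h : F =ᶠ[𝓝 y] F') (i : Fin 4) :
    pd i F y = pd i F' y := by
  rw [pd, pd, h.fderiv_eq]

theorem contDiffAt_pd {F : E4 → ℝ} {y : E4} (h : ContDiffAt ℝ ∞ F y) (i : Fin 4) :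
    ContDiffAt ℝ ∞ (pd i F) y :=
  (h.fderiv_right (m := ∞) le_rfl).clm_apply contDiffAt_const

theorem differentiableAt_of_contDiffAt {F : E4 → ℝ} {y : E4} (h : ContDiffAt ℝ ∞ F y) :
    DifferentiableAt ℝ F y :=
  h.differentiableAt (by simp)

theorem pd_const (i : Fin 4) (c : ℝ) (y : E4) : pd i (fun _ => c) y = 0 := by
  simp [pd]

theorem pd_add {F F' : E4 → ℝ} {y : E4} (h : DifferentiableAt ℝ F y)
    (h' : DifferentiableAt ℝ F' y) (i : Fin 4) :
    pd i (fun z => F z + F' z) y = pd i F y + pd i F' y := by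
  rw [pd, fderiv_fun_add h h']; rfl

theorem pd_sub {F F' : E4 → ℝ} {y : E4} (h : DifferentiableAt ℝ F y)
    (h' : DifferentiableAt ℝ F' y) (i : Fin 4) :
    pd i (fun z => F z - F' z) y = pd i F y - pd i F' y := by
  rw [pd, fderiv_fun_sub h h']; rfl

theorem pd_mul {F F' : E4 → ℝ} {y : E4} (h : DifferentiableAt ℝ F y)
    (h' : DifferentiableAt ℝ F' y) (i : Fin 4) :
    pd i (fun z => F z * F' z) y = pd i F y * F' y + F y * pd i F' y := by
  rw [pd, fderiv_fun_mul h h']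
  simp [pd]; ring

theorem pd_const_mul {F : E4 → ℝ} {y : E4} (h : DifferentiableAt ℝ F y) (c : ℝ) (i : Fin 4) :
    pd i (fun z => c * F z) y = c * pd i F y := by
  rw [pd_mul (differentiableAt_const c) h, pd_const]; ring

theorem pd_sum {ι : Type*} {s : Finset ι} {F : ι → E4 → ℝ} {y : E4}
    (h : ∀ a ∈ s, DifferentiableAt ℝ (F a) y) (i : Fin 4) :
    pd i (fun z => ∑ a ∈ s, F a z) y = ∑ a ∈ s, pd i (F a) y := by
  rw [pd, fderiv_fun_sum h]
  simp [pd]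

theorem pd_comm {F : E4 → ℝ} {y : E4} (h : ContDiffAt ℝ ∞ F y) (i j : Fin 4) :
    pd i (pd j F) y = pd j (pd i F) y := by
  have hs : IsSymmSndFDerivAt ℝ F y := h.isSymmSndFDerivAt (by
    rw [minSmoothness_of_isRCLikeNormedField]; exact WithTop.coe_le_coe.2 le_top)
  have hd : DifferentiableAt ℝ (fderiv ℝ F) y :=
    (h.fderiv_right (m := ∞) le_rfl).differentiableAt (by simp)
  have key : ∀ i j : Fin 4, pd i (pd j F) y =
      fderiv ℝ (fderiv ℝ F) y (EuclideanSpace.single i 1) (EuclideanSpace.single j 1) := by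
    intro i j
    have : pd j F = fun z => fderiv ℝ F z (EuclideanSpace.single j 1) := rfl
    rw [this, pd, fderiv_clm_apply hd (differentiableAt_const _)]
    simp
  rw [key, key]
  exact hs.eq _ _

variable {m n l : Type*}

/-- The entrywise coordinate derivative of a matrix of functions. -/
def pdMat (i : Fin 4) (A : E4 → Matrix m n ℝ) (y : E4) : Matrix m n ℝ :=
  Matrix.of fun a b => pd i (fun z => A z a b) y

/-- All entries of the matrix of functions are smooth at `y`. -/
def SmoothMatAt (A : E4 → Matrix m n ℝ) (y : E4) : Prop :=
  ∀ a b, ContDiffAt ℝ ∞ (fun z => A z a b) y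

theorem SmoothMatAt.diff {A : E4 → Matrix m n ℝ} {y : E4} (h : SmoothMatAt A y) (a : m) (b : n) :
    DifferentiableAt ℝ (fun z => A z a b) y :=
  differentiableAt_of_contDiffAt (h a b)

theorem SmoothMatAt.add {A B : E4 → Matrix m n ℝ} {y : E4} (hA : SmoothMatAt A y)
    (hB : SmoothMatAt B y) : SmoothMatAt (fun z => A z + B z) y := fun a b =>
  (hA a b).add (hB a b)

theorem SmoothMatAt.sub {A B : E4 → Matrix m n ℝ} {y : E4} (hA : SmoothMatAt A y)
    (hB : SmoothMatAt B y) : SmoothMatAt (fun z => A z - B z) y := fun a b =>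
  (hA a b).sub (hB a b)

theorem SmoothMatAt.transpose {A : E4 → Matrix m n ℝ} {y : E4} (hA : SmoothMatAt A y) :
    SmoothMatAt (fun z => (A z).transpose) y := fun a b => hA b a

theorem SmoothMatAt.mul [Fintype n] {A : E4 → Matrix m n ℝ} {B : E4 → Matrix n l ℝ} {y : E4}
    (hA : SmoothMatAt A y) (hB : SmoothMatAt B y) : SmoothMatAt (fun z => A z * B z) y :=
  fun a b => by
    simp only [Matrix.mul_apply]
    exact ContDiffAt.sum fun c _ => (hA a c).mul (hB c b)

theorem SmoothMatAt.pdMat {A : E4 → Matrix m n ℝ} {y : E4} (hA : SmoothMatAt A y) (i : Fin 4) :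
    SmoothMatAt (pdMat i A) y := fun a b => contDiffAt_pd (hA a b) i

theorem pdMat_congr {A B : E4 → Matrix m n ℝ} {y : E4} (h : A =ᶠ[𝓝 y] B) (i : Fin 4) :
    pdMat i A y = pdMat i B y := by
  ext a b
  exact pd_congr (h.mono fun z hz => by simp only [hz]) i

theorem pdMat_add {A B : E4 → Matrix m n ℝ} {y : E4} (hA : SmoothMatAt A y)
    (hB : SmoothMatAt B y) (i : Fin 4) :
    pdMat i (fun z => A z + B z) y = pdMat i A y + pdMat i B y := by
  ext a b
  exact pd_add (hA.diff a b) (hB.diff a b) i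

theorem pdMat_sub {A B : E4 → Matrix m n ℝ} {y : E4} (hA : SmoothMatAt A y)
    (hB : SmoothMatAt B y) (i : Fin 4) :
    pdMat i (fun z => A z - B z) y = pdMat i A y - pdMat i B y := by
  ext a b
  exact pd_sub (hA.diff a b) (hB.diff a b) i

theorem pdMat_transpose (A : E4 → Matrix m n ℝ) (y : E4) (i : Fin 4) :
    pdMat i (fun z => (A z).transpose) y = (pdMat i A y).transpose := rfl

theorem pdMat_mul [Fintype n] {A : E4 → Matrix m n ℝ} {B : E4 → Matrix n l ℝ} {y : E4}
    (hA : SmoothMatAt A y) (hB : SmoothMatAt B y) (i : Fin 4) :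
    pdMat i (fun z => A z * B z) y = pdMat i A y * B y + A y * pdMat i B y := by
  ext a b
  simp only [pdMat, Matrix.of_apply, Matrix.mul_apply, Matrix.add_apply]
  rw [pd_sum fun c _ => (hA.diff a c).fun_mul (hB.diff c b), ← Finset.sum_add_distrib]
  exact Finset.sum_congr rfl fun c _ => pd_mul (hA.diff a c) (hB.diff c b) i

theorem pdMat_comm {A : E4 → Matrix m n ℝ} {y : E4} (hA : SmoothMatAt A y) (i j : Fin 4) :
    pdMat i (pdMat j A) y = pdMat j (pdMat i A) y := by
  ext a b
  exact pd_comm (hA a b) i j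

theorem pd_trace [Fintype n] {A : E4 → Matrix n n ℝ} {y : E4} (hA : SmoothMatAt A y)
    (i : Fin 4) : pd i (fun z => (A z).trace) y = (pdMat i A y).trace := by
  simp only [Matrix.trace, Matrix.diag]
  exact pd_sum (fun c _ => hA.diff c c) i

section Determinant

variable [Fintype n] [DecidableEq n]

theorem SmoothMatAt.det {A : E4 → Matrix n n ℝ} {y : E4} (hA : SmoothMatAt A y) :
    ContDiffAt ℝ ∞ (fun z => (A z).det) y := by
  simp only [Matrix.det_apply']
  exact ContDiffAt.sum fun σ _ => contDiffAt_const.mul (contDiffAt_prod fun c _ => hA _ _)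

theorem SmoothMatAt.inv {A : E4 → Matrix n n ℝ} {y : E4} (hA : SmoothMatAt A y)
    (h : (A y).det ≠ 0) : SmoothMatAt (fun z => (A z)⁻¹) y := by
  intro a b
  simp only [Matrix.inv_def, Ring.inverse_eq_inv', Matrix.smul_apply, smul_eq_mul,
    Matrix.adjugate_apply]
  refine (hA.det.inv h).mul (SmoothMatAt.det (A := fun z => (A z).updateRow b (Pi.single a 1)) ?_)
  intro c d
  by_cases hc : c = b
  · subst hc
    simp only [Matrix.updateRow_self]
    exact contDiffAt_const
  · simp only [Matrix.updateRow_ne hc]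
    exact hA c d

/-- Jacobi's formula for the derivative of a determinant. -/
theorem pd_det {A : E4 → Matrix n n ℝ} {y : E4} (hA : SmoothMatAt A y) (i : Fin 4) :
    pd i (fun z => (A z).det) y = ((A y).adjugate * pdMat i A y).trace := by
  have hprod : ∀ σ : Equiv.Perm n, DifferentiableAt ℝ (fun z => ∏ c, A z (σ c) c) y := fun σ =>
    differentiableAt_of_contDiffAt (contDiffAt_prod fun c _ => hA _ _)
  have h1 : pd i (fun z => (A z).det) y =
      ∑ r, ((A y).updateCol r fun a => pdMat i A y a r).det := by
    simp only [Matrix.det_apply']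
    rw [pd_sum fun σ _ => (differentiableAt_const _).fun_mul (hprod σ), Finset.sum_comm]
    refine Finset.sum_congr rfl fun σ _ => ?_
    rw [pd_const_mul (hprod σ), ← Finset.mul_sum]
    congr 1
    rw [pd, fderiv_finsetProd fun c _ => hA.diff _ _]
    simp only [FunLike.coe_sum, Finset.sum_apply, _root_.smul_apply,
      smul_eq_mul]
    refine Finset.sum_congr rfl fun r _ => ?_
    rw [← Finset.mul_prod_erase Finset.univ _ (Finset.mem_univ r), Matrix.updateCol_self, mul_comm]
    congr 1
    refine Finset.prod_congr rfl fun c hc => ?_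
    rw [Matrix.updateCol_ne (Finset.ne_of_mem_erase hc)]
  rw [h1]
  simp only [← Matrix.cramer_apply, Matrix.cramer_eq_adjugate_mulVec, Matrix.trace, Matrix.diag,
    Matrix.mul_apply, Matrix.mulVec, dotProduct]

end Determinant

end

/-! ### The Levi-Civita connection and its curvature in matrix form -/

section

/-- `G` is the matrix of components of a smooth Riemannian metric on the open set `U`. Symmetry is
asked for everywhere, which makes the Christoffel symbols symmetric everywhere. -/
structure IsMetricOn (G : E4 → Matrix (Fin 4) (Fin 4) ℝ) (U : Set E4) : Prop where
  isOpen : IsOpen U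
  symm : ∀ y, (G y)ᵀ = G y
  smooth : ∀ y ∈ U, SmoothMatAt G y
  posDef : ∀ y ∈ U, (G y).PosDef

/-- The connection matrix `Γᵢ` with entries `(Γᵢ)^h_l = Γ^h_{il}`. -/
def connMat (G : E4 → Matrix (Fin 4) (Fin 4) ℝ) (i : Fin 4) (y : E4) : Matrix (Fin 4) (Fin 4) ℝ :=
  Matrix.of fun h l => christoffel G h i l y

/-- The curvature matrix `∂ᵢΓⱼ - ∂ⱼΓᵢ + [Γᵢ, Γⱼ]`, with entries `R^h_{ijl}`. -/
def curvMat (G : E4 → Matrix (Fin 4) (Fin 4) ℝ) (i j : Fin 4) (y : E4) :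
    Matrix (Fin 4) (Fin 4) ℝ :=
  pdMat i (connMat G j) y - pdMat j (connMat G i) y
    + (connMat G i y * connMat G j y - connMat G j y * connMat G i y)

theorem riemannUp_eq_curvMat (G : E4 → Matrix (Fin 4) (Fin 4) ℝ) (h i j l : Fin 4) (y : E4) :
    riemannUp G h i j l y = curvMat G i j y h l := by
  simp only [riemannUp, curvMat, Matrix.add_apply, Matrix.sub_apply, Matrix.mul_apply,
    Finset.sum_sub_distrib]
  rfl

variable {G : E4 → Matrix (Fin 4) (Fin 4) ℝ} {U : Set E4} {y : E4}

namespace IsMetricOn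

theorem symm_apply (hG : IsMetricOn G U) (y : E4) (i j : Fin 4) : G y i j = G y j i :=
  congrFun (congrFun (hG.symm y) j) i

theorem mem_nhds (hG : IsMetricOn G U) (hy : y ∈ U) : U ∈ 𝓝 y := hG.isOpen.mem_nhds hy

theorem det_pos (hG : IsMetricOn G U) (hy : y ∈ U) : 0 < (G y).det := (hG.posDef y hy).det_pos

theorem isUnit_det (hG : IsMetricOn G U) (hy : y ∈ U) : IsUnit (G y).det :=
  (hG.det_pos hy).ne'.isUnit

theorem mul_inv (hG : IsMetricOn G U) (hy : y ∈ U) : G y * (G y)⁻¹ = 1 :=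
  Matrix.mul_nonsing_inv _ (hG.isUnit_det hy)

theorem inv_mul (hG : IsMetricOn G U) (hy : y ∈ U) : (G y)⁻¹ * G y = 1 :=
  Matrix.nonsing_inv_mul _ (hG.isUnit_det hy)

theorem inv_transpose (hG : IsMetricOn G U) (y : E4) : ((G y)⁻¹)ᵀ = (G y)⁻¹ := by
  rw [Matrix.transpose_nonsing_inv, hG.symm]

theorem inv_symm_apply (hG : IsMetricOn G U) (y : E4) (i j : Fin 4) :
    (G y)⁻¹ i j = (G y)⁻¹ j i :=
  congrFun (congrFun (hG.inv_transpose y) j) i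

theorem smooth_inv (hG : IsMetricOn G U) (hy : y ∈ U) : SmoothMatAt (fun z => (G z)⁻¹) y :=
  (hG.smooth y hy).inv (hG.det_pos hy).ne'

theorem christoffel_symm (hG : IsMetricOn G U) (k i j : Fin 4) (y : E4) :
    christoffel G k i j y = christoffel G k j i y := by
  have h : (fun z => G z i j) = fun z => G z j i := funext fun z => hG.symm_apply z i j
  simp only [christoffel, h]
  congr 1
  refine Finset.sum_congr rfl fun l _ => ?_
  ring

theorem smooth_connMat (hG : IsMetricOn G U) (hy : y ∈ U) (i : Fin 4) :
    SmoothMatAt (connMat G i) y := by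
  intro h l
  have hs := hG.smooth y hy
  simp only [connMat, christoffel, Matrix.of_apply]
  exact contDiffAt_const.mul (ContDiffAt.sum fun c _ => (hG.smooth_inv hy h c).mul
    (((contDiffAt_pd (hs _ _) _).add (contDiffAt_pd (hs _ _) _)).sub (contDiffAt_pd (hs _ _) _)))

theorem smooth_curvMat (hG : IsMetricOn G U) (hy : y ∈ U) (i j : Fin 4) :
    SmoothMatAt (curvMat G i j) y :=
  (((hG.smooth_connMat hy j).pdMat i).sub ((hG.smooth_connMat hy i).pdMat j)).add
    (((hG.smooth_connMat hy i).mul (hG.smooth_connMat hy j)).sub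
      ((hG.smooth_connMat hy j).mul (hG.smooth_connMat hy i)))

/-- The metric is parallel: `∂ₘ g = Γₘᵀ g + g Γₘ`. -/
theorem pdMat_metric (hG : IsMetricOn G U) (hy : y ∈ U) (m : Fin 4) :
    pdMat m G y = (connMat G m y)ᵀ * G y + G y * connMat G m y := by
  let C : Matrix (Fin 4) (Fin 4) ℝ := Matrix.of fun n l =>
    (1 / 2) * (pd m (fun z => G z l n) y + pd l (fun z => G z m n) y - pd n (fun z => G z m l) y)
  have h1 : connMat G m y = (G y)⁻¹ * C := by
    ext h l
    simp only [connMat, christoffel, Matrix.of_apply, Matrix.mul_apply, C, Finset.mul_sum]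
    exact Finset.sum_congr rfl fun c _ => by ring
  have h2 : G y * connMat G m y = C := by
    rw [h1, ← Matrix.mul_assoc, hG.mul_inv hy, Matrix.one_mul]
  have h3 : (connMat G m y)ᵀ * G y = Cᵀ := by
    rw [← h2, Matrix.transpose_mul, hG.symm]
  rw [h2, h3]
  ext j l
  have h : ∀ i j, (fun z => G z i j) = fun z => G z j i := fun i j =>
    funext fun z => hG.symm_apply z i j
  simp only [pdMat, Matrix.of_apply, Matrix.add_apply, Matrix.transpose_apply, C]
  rw [h l j]
  ring

/-- The inverse metric is parallel. -/
theorem pdMat_inv (hG : IsMetricOn G U) (hy : y ∈ U) (m : Fin 4) :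
    pdMat m (fun z => (G z)⁻¹) y
      = -(connMat G m y * (G y)⁻¹) - (G y)⁻¹ * (connMat G m y)ᵀ := by
  have h1 : pdMat m (fun z => (G z)⁻¹ * G z) y = 0 := by
    have : (fun z => (G z)⁻¹ * G z) =ᶠ[𝓝 y] fun _ => 1 := by
      filter_upwards [hG.mem_nhds hy] with z hz using hG.inv_mul hz
    rw [pdMat_congr this]
    ext a b
    exact pd_const m _ y
  rw [pdMat_mul (hG.smooth_inv hy) (hG.smooth y hy), hG.pdMat_metric hy] at h1
  have h2 := congrArg (fun A => A * (G y)⁻¹) h1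
  simp only [Matrix.add_mul, Matrix.mul_add, Matrix.zero_mul, Matrix.mul_assoc, hG.mul_inv hy,
    Matrix.mul_one] at h2
  rw [← Matrix.mul_assoc _ (G y), hG.inv_mul hy, Matrix.one_mul] at h2
  rw [eq_comm, ← sub_eq_zero, ← neg_eq_zero, ← h2]
  abel

theorem curvMat_antisymm (G : E4 → Matrix (Fin 4) (Fin 4) ℝ) (i j : Fin 4) (y : E4) :
    curvMat G j i y = -curvMat G i j y := by
  simp only [curvMat]; abel

theorem riemann_eq (hG : IsMetricOn G U) (y : E4) (i j k l : Fin 4) :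
    riemann G y i j k l = (G y * curvMat G i j y) k l := by
  simp only [riemann, riemannUp_eq_curvMat, Matrix.mul_apply]
  exact Finset.sum_congr rfl fun h _ => by rw [hG.symm_apply]

/-- Second derivatives of a parallel metric commute, so the curvature matrices are skew. -/
theorem metric_mul_curvMat_skew (hG : IsMetricOn G U) (hy : y ∈ U) (i j : Fin 4) :
    (G y * curvMat G i j y)ᵀ = -(G y * curvMat G i j y) := by
  have key : ∀ i j, pdMat i (pdMat j G) y =
      (pdMat i (connMat G j) y)ᵀ * G y
        + (connMat G j y)ᵀ * ((connMat G i y)ᵀ * G y + G y * connMat G i y)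
        + (((connMat G i y)ᵀ * G y + G y * connMat G i y) * connMat G j y
        + G y * pdMat i (connMat G j) y) := by
    intro i j
    have : pdMat j G =ᶠ[𝓝 y] fun z => (connMat G j z)ᵀ * G z + G z * connMat G j z := by
      filter_upwards [hG.mem_nhds hy] with z hz using hG.pdMat_metric hz j
    have hΓ := hG.smooth_connMat hy j
    have hs := hG.smooth y hy
    rw [pdMat_congr this, pdMat_add (hΓ.transpose.mul hs) (hs.mul hΓ),
      pdMat_mul hΓ.transpose hs, pdMat_mul hs hΓ, pdMat_transpose, hG.pdMat_metric hy]
  have h := pdMat_comm (hG.smooth y hy) i j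
  rw [key, key] at h
  rw [Matrix.transpose_mul, hG.symm, ← add_eq_zero_iff_eq_neg]
  simp only [curvMat, Matrix.transpose_add, Matrix.transpose_sub, Matrix.transpose_mul]
  rw [← sub_eq_zero] at h
  rw [← h]
  noncomm_ring

/-- The differential Bianchi identity for the curvature matrices of a connection. -/
theorem bianchi_curvMat (hG : IsMetricOn G U) (hy : y ∈ U) (m i j : Fin 4) :
    (pdMat m (curvMat G i j) y + (connMat G m y * curvMat G i j y
        - curvMat G i j y * connMat G m y))
      + (pdMat i (curvMat G j m) y + (connMat G i y * curvMat G j m y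
        - curvMat G j m y * connMat G i y))
      + (pdMat j (curvMat G m i) y + (connMat G j y * curvMat G m i y
        - curvMat G m i y * connMat G j y)) = 0 := by
  have hΓ := hG.smooth_connMat hy
  have key : ∀ m i j, pdMat m (curvMat G i j) y =
      pdMat m (pdMat i (connMat G j)) y - pdMat m (pdMat j (connMat G i)) y
      + ((pdMat m (connMat G i) y * connMat G j y + connMat G i y * pdMat m (connMat G j) y)
        - (pdMat m (connMat G j) y * connMat G i y
          + connMat G j y * pdMat m (connMat G i) y)) := by
    intro m i j
    rw [← pdMat_mul (hΓ i) (hΓ j), ← pdMat_mul (hΓ j) (hΓ i),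
      ← pdMat_sub ((hΓ i).mul (hΓ j)) ((hΓ j).mul (hΓ i)),
      ← pdMat_sub ((hΓ j).pdMat i) ((hΓ i).pdMat j),
      ← pdMat_add (((hΓ j).pdMat i).sub ((hΓ i).pdMat j))
        (((hΓ i).mul (hΓ j)).sub ((hΓ j).mul (hΓ i)))]
    rfl
  rw [key, key, key, pdMat_comm (hΓ j) i m, pdMat_comm (hΓ i) j m, pdMat_comm (hΓ m) j i]
  simp only [curvMat]
  noncomm_ring

end IsMetricOn

/-! ### Algebraic curvature tensors -/

/-- The algebraic symmetries of a curvature tensor. -/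
structure IsCurvatureLike (T : Fin 4 → Fin 4 → Fin 4 → Fin 4 → ℝ) : Prop where
  antisymm_left : ∀ i j k l, T j i k l = -T i j k l
  antisymm_right : ∀ i j k l, T i j l k = -T i j k l
  bianchi : ∀ i j k l, T i j k l + T j k i l + T k i j l = 0

/-- The pair symmetry follows from the other symmetries. -/
theorem IsCurvatureLike.pair_symm {T : Fin 4 → Fin 4 → Fin 4 → Fin 4 → ℝ}
    (hT : IsCurvatureLike T) (i j k l : Fin 4) : T i j k l = T k l i j := by
  have hL := hT.antisymm_left
  have hR := hT.antisymm_right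
  linarith [hT.bianchi i j k l, hT.bianchi j k l i, hT.bianchi k l i j, hT.bianchi l i j k,
    hR k i l j, hR i j l k, hR j k i l, hR j l i k, hR l i j k, hR k l i j, hL k i l j, hL i k j l,
    hR i k j l, hR l j k i, hL j l i k, hR j l k i, hL i j l k, hL k l j i, hL l i k j, hL j k i l,
    hR l i k j, hL i l j k, hL j k l i]

namespace IsMetricOn

theorem riemann_isCurvatureLike (hG : IsMetricOn G U) (hy : y ∈ U) :
    IsCurvatureLike (riemann G y) := by
  have hR : ∀ i j k l, riemann G y i j l k = -riemann G y i j k l := fun i j k l => by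
    rw [hG.riemann_eq, hG.riemann_eq]
    exact congrFun (congrFun (hG.metric_mul_curvMat_skew hy i j) k) l
  refine ⟨fun i j k l => ?_, hR, fun i j l k => ?_⟩
  · rw [hG.riemann_eq, hG.riemann_eq, curvMat_antisymm, Matrix.mul_neg, Matrix.neg_apply]
  · rw [hR i j k l, hR j l k i, hR l i k j, ← neg_add, ← neg_add, neg_eq_zero]
    simp only [riemann, ← Finset.sum_add_distrib, ← mul_add]
    refine Finset.sum_eq_zero fun h _ => ?_
    suffices riemannUp G h i j l y + riemannUp G h j l i y + riemannUp G h l i j y = 0 by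
      rw [this, mul_zero]
    have hs : ∀ a b, christoffel G h a b = christoffel G h b a := fun a b =>
      funext fun z => hG.christoffel_symm h a b z
    simp only [riemannUp, Finset.sum_sub_distrib]
    rw [hs l j, hs i l, hs j i]
    have hs' : ∀ m a b, christoffel G m a b y = christoffel G m b a y := fun m a b =>
      hG.christoffel_symm m a b y
    simp only [hs' _ l j, hs' _ i l, hs' _ j i]
    ring

theorem smooth_riemann (hG : IsMetricOn G U) (hy : y ∈ U) (i j k l : Fin 4) :
    ContDiffAt ℝ ∞ (fun z => riemann G z i j k l) y := by
  simp only [hG.riemann_eq]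
  exact (hG.smooth y hy).mul (hG.smooth_curvMat hy i j) k l

theorem smooth_ricci (hG : IsMetricOn G U) (hy : y ∈ U) (i k : Fin 4) :
    ContDiffAt ℝ ∞ (fun z => ricci G z i k) y :=
  ContDiffAt.sum fun j _ => ContDiffAt.sum fun l _ =>
    (hG.smooth_inv hy j l).mul (hG.smooth_riemann hy i j k l)

theorem smooth_scalar (hG : IsMetricOn G U) (hy : y ∈ U) : ContDiffAt ℝ ∞ (scalar G) y :=
  ContDiffAt.sum fun i _ => ContDiffAt.sum fun j _ =>
    (hG.smooth_inv hy i j).mul (hG.smooth_ricci hy i j)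

theorem ricci_symm (hG : IsMetricOn G U) (hy : y ∈ U) (i k : Fin 4) :
    ricci G y i k = ricci G y k i := by
  rw [ricci, ricci, Finset.sum_comm]
  refine Finset.sum_congr rfl fun l _ => Finset.sum_congr rfl fun j _ => ?_
  rw [hG.inv_symm_apply y j l, (hG.riemann_isCurvatureLike hy).pair_symm i j k l]

end IsMetricOn

/-! ### Covariant derivatives -/

theorem covDeriv_eq_neg_of_antisymm_left {T : Tensor4}
    (hT : ∀ᶠ z in 𝓝 y, ∀ i j k l, T z j i k l = -T z i j k l) (m i j k l : Fin 4) :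
    covDeriv G T y m j i k l = -covDeriv G T y m i j k l := by
  have h := hT.self_of_nhds
  have hd : pd m (fun z => T z j i k l) y = -pd m (fun z => T z i j k l) y := by
    rw [pd_congr (hT.mono fun z hz => hz i j k l)]
    simp [pd]
  rw [covDeriv, covDeriv, hd, neg_sub, sub_eq_add_neg, add_comm, sub_eq_add_neg, ← sub_eq_add_neg,
    sub_eq_add_neg, add_right_cancel_iff, ← Finset.sum_neg_distrib]
  refine Finset.sum_congr rfl fun a _ => ?_
  rw [h i a k l, h a j k l, h i j a l, h i j k a]
  ring

theorem covDeriv_eq_neg_of_antisymm_right {T : Tensor4}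
    (hT : ∀ᶠ z in 𝓝 y, ∀ i j k l, T z i j l k = -T z i j k l) (m i j k l : Fin 4) :
    covDeriv G T y m i j l k = -covDeriv G T y m i j k l := by
  have h := hT.self_of_nhds
  have hd : pd m (fun z => T z i j l k) y = -pd m (fun z => T z i j k l) y := by
    rw [pd_congr (hT.mono fun z hz => hz i j k l)]
    simp [pd]
  rw [covDeriv, covDeriv, hd, neg_sub, sub_eq_add_neg, add_comm, sub_eq_add_neg, ← sub_eq_add_neg,
    sub_eq_add_neg, add_right_cancel_iff, ← Finset.sum_neg_distrib]
  refine Finset.sum_congr rfl fun a _ => ?_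
  rw [h a j k l, h i a k l, h i j k a, h i j a l]
  ring

theorem covDeriv_pair_symm {T : Tensor4}
    (hT : ∀ᶠ z in 𝓝 y, ∀ i j k l, T z i j k l = T z k l i j) (m i j k l : Fin 4) :
    covDeriv G T y m i j k l = covDeriv G T y m k l i j := by
  have h := hT.self_of_nhds
  rw [covDeriv, covDeriv, pd_congr (hT.mono fun z hz => hz i j k l)]
  congr 1
  refine Finset.sum_congr rfl fun a _ => ?_
  rw [h a j k l, h i a k l, h i j a l, h i j k a]
  ring

/-- The covariant derivative `∇ₘS = ∂ₘS - Γₘᵀ S - S Γₘ` of a field of bilinear forms. -/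
def covMat (G S : E4 → Matrix (Fin 4) (Fin 4) ℝ) (m : Fin 4) (y : E4) :
    Matrix (Fin 4) (Fin 4) ℝ :=
  pdMat m S y - (connMat G m y)ᵀ * S y - S y * connMat G m y

theorem covMat_apply (G S : E4 → Matrix (Fin 4) (Fin 4) ℝ) (m : Fin 4) (y : E4) (i k : Fin 4) :
    covMat G S m y i k = pd m (fun z => S z i k) y
      - ∑ a, (christoffel G a m i y * S y a k + christoffel G a m k y * S y i a) := by
  simp only [covMat, Matrix.sub_apply, Matrix.mul_apply, Finset.sum_add_distrib, pdMat,
    Matrix.of_apply, connMat, Matrix.transpose_apply, sub_sub]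
  congr 2
  exact Finset.sum_congr rfl fun a _ => mul_comm _ _

/-- The field of matrices of the Ricci tensor. -/
def ricciMat (G : E4 → Matrix (Fin 4) (Fin 4) ℝ) (y : E4) : Matrix (Fin 4) (Fin 4) ℝ :=
  Matrix.of fun i k => ricci G y i k

theorem sum_mul_eq_trace (A S : Matrix (Fin 4) (Fin 4) ℝ) :
    ∑ j, ∑ l, A j l * S j l = (A * Sᵀ).trace := by
  simp only [Matrix.trace, Matrix.diag, Matrix.mul_apply, Matrix.transpose_apply]

namespace IsMetricOn

/-- Contraction with the inverse metric commutes with covariant differentiation. -/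
theorem pd_contract (hG : IsMetricOn G U) (hy : y ∈ U) {S : E4 → Matrix (Fin 4) (Fin 4) ℝ}
    (hS : SmoothMatAt S y) (m : Fin 4) :
    pd m (fun z => ∑ j, ∑ l, (G z)⁻¹ j l * S z j l) y
      = ∑ j, ∑ l, (G y)⁻¹ j l * covMat G S m y j l := by
  simp only [sum_mul_eq_trace]
  rw [pd_trace ((hG.smooth_inv hy).mul hS.transpose), pdMat_mul (hG.smooth_inv hy) hS.transpose,
    hG.pdMat_inv hy, pdMat_transpose, covMat]
  simp only [Matrix.transpose_sub, Matrix.transpose_mul, Matrix.transpose_transpose,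
    Matrix.sub_mul, Matrix.neg_mul, Matrix.mul_sub, Matrix.trace_add, Matrix.trace_sub,
    Matrix.trace_neg]
  rw [Matrix.mul_assoc (connMat G m y), Matrix.trace_mul_comm (connMat G m y), Matrix.mul_assoc,
    Matrix.mul_assoc]
  ring

theorem pd_scalar (hG : IsMetricOn G U) (hy : y ∈ U) (m : Fin 4) :
    pd m (scalar G) y = ∑ i, ∑ k, (G y)⁻¹ i k * covMat G (ricciMat G) m y i k :=
  hG.pd_contract (S := ricciMat G) hy (fun i k => hG.smooth_ricci hy i k) m

/-- The covariant derivative of the Ricci tensor is a contraction of `∇Rm`. -/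
theorem covMat_ricciMat (hG : IsMetricOn G U) (hy : y ∈ U) (m i k : Fin 4) :
    covMat G (ricciMat G) m y i k
      = ∑ j, ∑ l, (G y)⁻¹ j l * covDeriv G (riemann G) y m i j k l := by
  have h := hG.pd_contract (S := fun z => Matrix.of fun j l => riemann G z i j k l) hy
    (fun j l => hG.smooth_riemann hy i j k l) m
  rw [covMat_apply]
  have h' : pd m (fun z => ricciMat G z i k) y = _ := h
  rw [h']
  have h3 : ∑ a, (christoffel G a m i y * ricciMat G y a k + christoffel G a m k y * ricciMat G y i a)
      = ∑ j, ∑ l, ∑ a, (G y)⁻¹ j l * (christoffel G a m i y * riemann G y a j k l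
        + christoffel G a m k y * riemann G y i j a l) := by
    simp only [ricciMat, Matrix.of_apply, ricci, Finset.mul_sum, ← Finset.sum_add_distrib]
    rw [Finset.sum_comm]
    refine Finset.sum_congr rfl fun j _ => ?_
    rw [Finset.sum_comm]
    exact Finset.sum_congr rfl fun l _ => Finset.sum_congr rfl fun a _ => by ring
  rw [h3, ← Finset.sum_sub_distrib]
  refine Finset.sum_congr rfl fun j _ => ?_
  rw [← Finset.sum_sub_distrib]
  refine Finset.sum_congr rfl fun l _ => ?_
  rw [covMat_apply, covDeriv, ← Finset.mul_sum, ← mul_sub, sub_sub, ← Finset.sum_add_distrib]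
  congr 2
  exact Finset.sum_congr rfl fun a _ => by simp only [Matrix.of_apply]; ring

theorem covMat_ricciMat_symm (hG : IsMetricOn G U) (hy : y ∈ U) (m i k : Fin 4) :
    covMat G (ricciMat G) m y i k = covMat G (ricciMat G) m y k i := by
  have hd : pd m (fun z => ricciMat G z i k) y = pd m (fun z => ricciMat G z k i) y :=
    pd_congr (by filter_upwards [hG.mem_nhds hy] with z hz using hG.ricci_symm hz i k) m
  rw [covMat_apply, covMat_apply, hd]
  congr 1
  refine Finset.sum_congr rfl fun a _ => ?_
  simp only [ricciMat, Matrix.of_apply]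
  rw [hG.ricci_symm hy a k, hG.ricci_symm hy i a]
  ring

/-- The covariant derivative of the Riemann tensor in terms of the curvature matrices. -/
theorem covDeriv_riemann (hG : IsMetricOn G U) (hy : y ∈ U) (m i j k l : Fin 4) :
    covDeriv G (riemann G) y m i j k l
      = (G y * (pdMat m (curvMat G i j) y + (connMat G m y * curvMat G i j y
          - curvMat G i j y * connMat G m y))) k l
        - ∑ a, (christoffel G a m i y * riemann G y a j k l
          + christoffel G a m j y * riemann G y i a k l) := by
  have h1 : pd m (fun z => riemann G z i j k l) y
      = (pdMat m G y * curvMat G i j y + G y * pdMat m (curvMat G i j) y) k l := by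
    simp only [hG.riemann_eq]
    rw [← pdMat_mul (hG.smooth y hy) (hG.smooth_curvMat hy i j)]
    rfl
  have h2 : ∑ a, christoffel G a m k y * riemann G y i j a l
      = ((connMat G m y)ᵀ * (G y * curvMat G i j y)) k l := by
    simp only [hG.riemann_eq]
    rfl
  have h3 : ∑ a, christoffel G a m l y * riemann G y i j k a
      = ((G y * curvMat G i j y) * connMat G m y) k l := by
    simp only [hG.riemann_eq]
    rw [Matrix.mul_apply]
    exact Finset.sum_congr rfl fun a _ => mul_comm _ _
  rw [covDeriv, h1, hG.pdMat_metric hy]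
  simp only [Finset.sum_add_distrib]
  rw [h2, h3]
  simp only [Matrix.add_mul, Matrix.mul_add, Matrix.mul_sub, Matrix.add_apply, Matrix.sub_apply,
    Matrix.mul_assoc]
  ring

/-- The second Bianchi identity. -/
theorem covDeriv_riemann_bianchi (hG : IsMetricOn G U) (hy : y ∈ U) (m i j k l : Fin 4) :
    covDeriv G (riemann G) y m i j k l + covDeriv G (riemann G) y i j m k l
      + covDeriv G (riemann G) y j m i k l = 0 := by
  have h0 := congrArg (HMul.hMul (G y)) (hG.bianchi_curvMat hy m i j)
  rw [Matrix.mul_zero, Matrix.mul_add, Matrix.mul_add] at h0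
  have h := congrFun (congrFun h0 k) l
  rw [Matrix.add_apply, Matrix.add_apply, Matrix.zero_apply] at h
  have hs : ∀ a b c, christoffel G a b c y = christoffel G a c b y := fun a b c =>
    hG.christoffel_symm a b c y
  have hA := (hG.riemann_isCurvatureLike hy).antisymm_left
  have hz : ∑ a, (christoffel G a m i y * riemann G y a j k l
          + christoffel G a m j y * riemann G y i a k l)
      + ∑ a, (christoffel G a i j y * riemann G y a m k l
          + christoffel G a i m y * riemann G y j a k l)
      + ∑ a, (christoffel G a j m y * riemann G y a i k l
          + christoffel G a j i y * riemann G y m a k l) = 0 := by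
    simp only [← Finset.sum_add_distrib]
    refine Finset.sum_eq_zero fun a _ => ?_
    rw [hs a i m, hs a j m, hs a j i, hA a j k l, hA a i k l, hA a m k l]
    ring
  rw [hG.covDeriv_riemann hy, hG.covDeriv_riemann hy, hG.covDeriv_riemann hy]
  linarith

end IsMetricOn

end

/-! ### Divergences of the Riemann, Ricci and Weyl tensors -/

section

variable {G : E4 → Matrix (Fin 4) (Fin 4) ℝ} {U : Set E4} {y : E4}

namespace IsMetricOn

/-- The contracted second Bianchi identity `∇ⁱ R_{ijkl} = ∇ₖ R_{lj} - ∇ₗ R_{kj}`. -/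
theorem divergence_riemann (hG : IsMetricOn G U) (hy : y ∈ U) (j k l : Fin 4) :
    divergence G (riemann G) y j k l
      = covMat G (ricciMat G) k y l j - covMat G (ricciMat G) l y k j := by
  have hnear : ∀ᶠ z in 𝓝 y, IsCurvatureLike (riemann G z) := by
    filter_upwards [hG.mem_nhds hy] with z hz using hG.riemann_isCurvatureLike hz
  have hL := covDeriv_eq_neg_of_antisymm_left (G := G) (hnear.mono fun z hz => hz.antisymm_left)
  have hR := covDeriv_eq_neg_of_antisymm_right (G := G) (hnear.mono fun z hz => hz.antisymm_right)
  have hP := covDeriv_pair_symm (G := G) (hnear.mono fun z hz => hz.pair_symm)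
  rw [hG.covMat_ricciMat hy, hG.covMat_ricciMat hy, divergence, ← Finset.sum_sub_distrib]
  refine Finset.sum_congr rfl fun m _ => ?_
  rw [← Finset.sum_sub_distrib]
  refine Finset.sum_congr rfl fun i _ => ?_
  rw [← mul_sub]
  congr 1
  have h := hG.covDeriv_riemann_bianchi hy m k l i j
  rw [hP m i j k l]
  linarith [hL l k m i j, hR l k m i j, hR k l m i j]

/-- The contracted second Bianchi identity `∇ⁱ R_{ik} = ½ ∂ₖ R`. -/
theorem divergence_ricci (hG : IsMetricOn G U) (hy : y ∈ U) (k : Fin 4) :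
    ∑ m, ∑ i, (G y)⁻¹ m i * covMat G (ricciMat G) m y i k = 1 / 2 * pd k (scalar G) y := by
  have h1 : ∑ j, ∑ l, (G y)⁻¹ j l * divergence G (riemann G) y j k l
      = ∑ m, ∑ i, (G y)⁻¹ m i * covMat G (ricciMat G) m y i k := by
    simp only [hG.covMat_ricciMat hy, divergence, Finset.mul_sum]
    calc ∑ j, ∑ l, ∑ m, ∑ i, (G y)⁻¹ j l * ((G y)⁻¹ m i * covDeriv G (riemann G) y m i j k l)
        = ∑ j, ∑ m, ∑ l, ∑ i, (G y)⁻¹ j l *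
            ((G y)⁻¹ m i * covDeriv G (riemann G) y m i j k l) :=
          Finset.sum_congr rfl fun j _ => Finset.sum_comm
      _ = ∑ m, ∑ j, ∑ i, ∑ l, (G y)⁻¹ j l *
            ((G y)⁻¹ m i * covDeriv G (riemann G) y m i j k l) := by
          rw [Finset.sum_comm]
          exact Finset.sum_congr rfl fun m _ => Finset.sum_congr rfl fun j _ => Finset.sum_comm
      _ = _ := by
          refine Finset.sum_congr rfl fun m _ => ?_
          rw [Finset.sum_comm]
          exact Finset.sum_congr rfl fun i _ => Finset.sum_congr rfl fun j _ =>
            Finset.sum_congr rfl fun l _ => by ring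
  have h2 : ∑ j, ∑ l, (G y)⁻¹ j l * divergence G (riemann G) y j k l
      = pd k (scalar G) y - ∑ m, ∑ i, (G y)⁻¹ m i * covMat G (ricciMat G) m y i k := by
    simp only [hG.divergence_riemann hy, mul_sub, Finset.sum_sub_distrib]
    rw [hG.pd_scalar hy]
    congr 1
    · exact Finset.sum_congr rfl fun j _ => Finset.sum_congr rfl fun l _ => by
        rw [hG.covMat_ricciMat_symm hy]
    · rw [Finset.sum_comm]
      exact Finset.sum_congr rfl fun l _ => Finset.sum_congr rfl fun j _ => by
        rw [hG.covMat_ricciMat_symm hy, hG.inv_symm_apply]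
  linarith

theorem covDeriv_weyl (hG : IsMetricOn G U) (hy : y ∈ U) (m i j k l : Fin 4) :
    covDeriv G (weyl G) y m i j k l = covDeriv G (riemann G) y m i j k l
      - (1 / 2) * (covMat G (ricciMat G) m y i k * G y j l + covMat G (ricciMat G) m y j l * G y i k
        - covMat G (ricciMat G) m y i l * G y j k - covMat G (ricciMat G) m y j k * G y i l)
      + pd m (scalar G) y / 6 * (G y i k * G y j l - G y i l * G y j k) := by
  have hg : ∀ a b, DifferentiableAt ℝ (fun z => G z a b) y := (hG.smooth y hy).diff
  have hr : ∀ a b, DifferentiableAt ℝ (fun z => ricci G z a b) y := fun a b =>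
    differentiableAt_of_contDiffAt (hG.smooth_ricci hy a b)
  have hR : DifferentiableAt ℝ (fun z => riemann G z i j k l) y :=
    differentiableAt_of_contDiffAt (hG.smooth_riemann hy i j k l)
  have hs : DifferentiableAt ℝ (fun z => scalar G z) y :=
    differentiableAt_of_contDiffAt (hG.smooth_scalar hy)
  have hrg : ∀ a b c d, DifferentiableAt ℝ (fun z => ricci G z a b * G z c d) y := fun a b c d =>
    (hr a b).fun_mul (hg c d)
  have hgg : ∀ a b c d, DifferentiableAt ℝ (fun z => G z a b * G z c d) y := fun a b c d =>
    (hg a b).fun_mul (hg c d)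
  have hpd : pd m (fun z => weyl G z i j k l) y = pd m (fun z => riemann G z i j k l) y
      - (1 / 2) * (pd m (fun z => ricci G z i k * G z j l) y
        + pd m (fun z => ricci G z j l * G z i k) y - pd m (fun z => ricci G z i l * G z j k) y
        - pd m (fun z => ricci G z j k * G z i l) y)
      + (1 / 6) * pd m (fun z => scalar G z * (G z i k * G z j l - G z i l * G z j k)) y := by
    have e : (fun z => weyl G z i j k l) = fun z => riemann G z i j k l
        - (1 / 2) * (ricci G z i k * G z j l + ricci G z j l * G z i k - ricci G z i l * G z j k
          - ricci G z j k * G z i l)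
        + (1 / 6) * (scalar G z * (G z i k * G z j l - G z i l * G z j k)) :=
      funext fun z => by simp only [weyl]; ring
    have d1 := ((hrg i k j l).fun_add (hrg j l i k)).fun_sub (hrg i l j k)
    have d2 := d1.fun_sub (hrg j k i l)
    have d3 := hs.fun_mul ((hgg i k j l).fun_sub (hgg i l j k))
    rw [e, pd_add (hR.fun_sub ((differentiableAt_const _).fun_mul d2))
      ((differentiableAt_const _).fun_mul d3), pd_sub hR ((differentiableAt_const _).fun_mul d2),
      pd_const_mul d2, pd_const_mul d3, pd_sub d1 (hrg j k i l),
      pd_sub ((hrg i k j l).fun_add (hrg j l i k)) (hrg i l j k),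
      pd_add (hrg i k j l) (hrg j l i k)]
  have hdg : ∀ a b, pd m (fun z => G z a b) y
      = ∑ c, (christoffel G c m a y * G y c b + christoffel G c m b y * G y a c) := by
    intro a b
    have h := congrFun (congrFun (hG.pdMat_metric hy m) a) b
    simp only [Matrix.add_apply, Matrix.mul_apply, ← Finset.sum_add_distrib] at h
    refine h.trans (Finset.sum_congr rfl fun c _ => ?_)
    simp only [connMat, Matrix.transpose_apply, Matrix.of_apply]
    ring
  have hdr : ∀ a b, pd m (fun z => ricci G z a b) y = covMat G (ricciMat G) m y a b
      + ∑ c, (christoffel G c m a y * ricci G y c b + christoffel G c m b y * ricci G y a c) := by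
    intro a b
    rw [covMat_apply]
    simp only [ricciMat, Matrix.of_apply]
    ring
  have hdR := sub_eq_iff_eq_add.1 (show covDeriv G (riemann G) y m i j k l = _ from rfl).symm
  rw [covDeriv, hpd, hdR, pd_mul (hr _ _) (hg _ _), pd_mul (hr _ _) (hg _ _),
    pd_mul (hr _ _) (hg _ _), pd_mul (hr _ _) (hg _ _),
    pd_mul hs ((hgg i k j l).fun_sub (hgg i l j k)), pd_sub (hgg i k j l) (hgg i l j k),
    pd_mul (hg _ _) (hg _ _), pd_mul (hg _ _) (hg _ _)]
  simp only [hdg, hdr, Fin.sum_univ_four, weyl]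
  ring

theorem sum_inv_mul_metric (hG : IsMetricOn G U) (hy : y ∈ U) (X : Fin 4 → ℝ) (k : Fin 4) :
    ∑ m, ∑ i, (G y)⁻¹ m i * (X m * G y i k) = X k := by
  have h : ∀ m, ∑ i, (G y)⁻¹ m i * (X m * G y i k) = X m * (1 : Matrix (Fin 4) (Fin 4) ℝ) m k := by
    intro m
    rw [← hG.inv_mul hy, Matrix.mul_apply, Finset.mul_sum]
    exact Finset.sum_congr rfl fun i _ => by ring
  simp only [h, Matrix.one_apply]
  simp

theorem divergence_weyl (hG : IsMetricOn G U) (hy : y ∈ U) (j k l : Fin 4) :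
    divergence G (weyl G) y j k l
      = 1 / 2 * (covMat G (ricciMat G) k y l j - covMat G (ricciMat G) l y k j)
        - 1 / 12 * (pd k (scalar G) y * G y j l - pd l (scalar G) y * G y j k) := by
  have e : ∀ m i, (G y)⁻¹ m i * covDeriv G (weyl G) y m i j k l
      = (G y)⁻¹ m i * covDeriv G (riemann G) y m i j k l
        - (1 / 2 * G y j l) * ((G y)⁻¹ m i * covMat G (ricciMat G) m y i k)
        - 1 / 2 * ((G y)⁻¹ m i * (covMat G (ricciMat G) m y j l * G y i k))
        + (1 / 2 * G y j k) * ((G y)⁻¹ m i * covMat G (ricciMat G) m y i l)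
        + 1 / 2 * ((G y)⁻¹ m i * (covMat G (ricciMat G) m y j k * G y i l))
        + 1 / 6 * G y j l * ((G y)⁻¹ m i * (pd m (scalar G) y * G y i k))
        - 1 / 6 * G y j k * ((G y)⁻¹ m i * (pd m (scalar G) y * G y i l)) := by
    intro m i
    rw [hG.covDeriv_weyl hy]
    ring
  have hR := hG.divergence_riemann hy j k l
  rw [divergence] at hR ⊢
  simp only [e, Finset.sum_add_distrib, Finset.sum_sub_distrib, ← Finset.mul_sum, hR,
    hG.divergence_ricci hy, hG.sum_inv_mul_metric hy (fun m => pd m (scalar G) y)]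
  rw [hG.sum_inv_mul_metric hy (fun m => covMat G (ricciMat G) m y j l),
    hG.sum_inv_mul_metric hy (fun m => covMat G (ricciMat G) m y j k),
    hG.covMat_ricciMat_symm hy k j l, hG.covMat_ricciMat_symm hy l j k]
  ring

/-! ### Gradient Ricci solitons -/

theorem smooth_hessian (hG : IsMetricOn G U) (hy : y ∈ U) {F : E4 → ℝ}
    (hF : ContDiffAt ℝ ∞ F y) : SmoothMatAt (fun z => Matrix.of (hessian G F z)) y := fun i j =>
  (contDiffAt_pd (contDiffAt_pd hF j) i).sub (ContDiffAt.sum fun k _ =>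
    (hG.smooth_connMat hy i k j).mul (contDiffAt_pd hF k))

/-- The Ricci identity: commuting covariant derivatives of `dF` produces the curvature. -/
theorem covMat_hessian_antisymm (hG : IsMetricOn G U) (hy : y ∈ U) {F : E4 → ℝ}
    (hF : ContDiffAt ℝ ∞ F y) (i j k : Fin 4) :
    covMat G (fun z => Matrix.of (hessian G F z)) i y j k
      - covMat G (fun z => Matrix.of (hessian G F z)) j y i k
      = -∑ h, curvMat G i j y h k * pd h F y := by
  let u : E4 → Matrix (Fin 4) Unit ℝ := fun z => Matrix.of fun k _ => pd k F z
  have hu : SmoothMatAt u y := fun k _ => contDiffAt_pd hF k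
  have hΓ := hG.smooth_connMat hy
  have hH : ∀ j, (fun z => Matrix.of fun k (_ : Unit) => hessian G F z j k)
      = fun z => pdMat j u z - (connMat G j z)ᵀ * u z := fun j => rfl
  have key : ∀ i j, covMat G (fun z => Matrix.of (hessian G F z)) i y j k
      = (pdMat i (pdMat j u) y - ((pdMat i (connMat G j) y)ᵀ * u y
          + (connMat G j y)ᵀ * pdMat i u y)
        - (connMat G i y)ᵀ * (pdMat j u y - (connMat G j y)ᵀ * u y)) k ()
        - ∑ a, christoffel G a i j y * hessian G F y a k := by
    intro i j
    rw [← pdMat_transpose, ← pdMat_mul (hΓ j).transpose hu,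
      ← pdMat_sub (hu.pdMat j) ((hΓ j).transpose.mul hu), ← hH j, covMat_apply,
      Finset.sum_add_distrib]
    have : pdMat j u y - (connMat G j y)ᵀ * u y = Matrix.of fun k (_ : Unit) => hessian G F y j k :=
      congrFun (hH j).symm y
    rw [this]
    simp only [Matrix.sub_apply, Matrix.mul_apply, pdMat, Matrix.of_apply, connMat,
      Matrix.transpose_apply]
    ring
  have hs : ∀ a, christoffel G a j i y = christoffel G a i j y := fun a =>
    hG.christoffel_symm a j i y
  have hR : ∑ h, curvMat G i j y h k * pd h F y = ((curvMat G i j y)ᵀ * u y) k () := rfl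
  rw [key, key, hR, pdMat_comm hu j i]
  simp only [hs]
  rw [sub_sub_sub_cancel_right, ← Matrix.sub_apply, ← Matrix.neg_apply]
  refine congrFun (congrFun ?_ k) ()
  simp only [curvMat, Matrix.transpose_add, Matrix.transpose_sub, Matrix.transpose_mul,
    Matrix.add_mul, Matrix.sub_mul, Matrix.mul_sub, Matrix.mul_assoc]
  abel

variable {F : E4 → ℝ} {lam : ℝ} {v : Fin 4 → ℝ}

/-- On a gradient soliton the Codazzi defect of the Ricci tensor is `R_{ijak} ∇ᵃF`. -/
theorem covMat_ricciMat_sub_of_soliton (hG : IsMetricOn G U) (hy : y ∈ U)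
    (hF : ContDiffAt ℝ ∞ F y)
    (hsol : ∀ z ∈ U, ∀ i j, ricci G z i j + hessian G F z i j = lam * G z i j)
    (hv : ∀ h, pd h F y = ∑ a, G y h a * v a) (i j k : Fin 4) :
    covMat G (ricciMat G) i y j k - covMat G (ricciMat G) j y i k
      = ∑ a, riemann G y i j a k * v a := by
  have hcov : ∀ i, covMat G (ricciMat G) i y
      = -covMat G (fun z => Matrix.of (hessian G F z)) i y := by
    intro i
    have hs := hG.smooth y hy
    have hc : SmoothMatAt (fun _ => lam • (1 : Matrix (Fin 4) (Fin 4) ℝ)) y :=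
      fun _ _ => contDiffAt_const
    have h : ricciMat G =ᶠ[𝓝 y]
        fun z => (lam • (1 : Matrix (Fin 4) (Fin 4) ℝ)) * G z - Matrix.of (hessian G F z) := by
      filter_upwards [hG.mem_nhds hy] with z hz
      ext a b
      rw [Matrix.smul_mul, Matrix.one_mul]
      simp only [ricciMat, Matrix.of_apply, Matrix.sub_apply, Matrix.smul_apply, smul_eq_mul]
      linarith [hsol z hz a b]
    have hc0 : pdMat i (fun _ => lam • (1 : Matrix (Fin 4) (Fin 4) ℝ)) y = 0 := by
      ext a b
      exact pd_const i _ y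
    rw [covMat, covMat, pdMat_congr h, h.self_of_nhds, pdMat_sub (hc.mul hs)
      (hG.smooth_hessian hy hF), pdMat_mul hc hs, hc0, hG.pdMat_metric hy]
    simp only [Matrix.smul_mul, Matrix.one_mul, Matrix.mul_sub, Matrix.sub_mul, Matrix.mul_smul,
      Matrix.zero_mul, smul_add]
    abel
  rw [hcov, hcov, Matrix.neg_apply, Matrix.neg_apply, neg_sub_neg, ← neg_sub,
    hG.covMat_hessian_antisymm hy hF, neg_neg]
  simp only [hv, riemann, riemannUp_eq_curvMat, Finset.mul_sum, Finset.sum_mul]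
  rw [Finset.sum_comm]
  exact Finset.sum_congr rfl fun a _ => Finset.sum_congr rfl fun h _ => by ring

/-- On a gradient soliton `dR = 2 Ric(∇F, ·)`, by tracing the formula for the Codazzi defect of the
Ricci tensor. -/
theorem pd_scalar_of_soliton (hG : IsMetricOn G U) (hy : y ∈ U) (hF : ContDiffAt ℝ ∞ F y)
    (hsol : ∀ z ∈ U, ∀ i j, ricci G z i j + hessian G F z i j = lam * G z i j)
    (hv : ∀ h, pd h F y = ∑ a, G y h a * v a) (i : Fin 4) :
    pd i (scalar G) y = 2 * ∑ a, ricci G y i a * v a := by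
  have h1 : ∑ j, ∑ k, (G y)⁻¹ j k *
      (covMat G (ricciMat G) i y j k - covMat G (ricciMat G) j y i k)
      = pd i (scalar G) y - 1 / 2 * pd i (scalar G) y := by
    simp only [mul_sub, Finset.sum_sub_distrib]
    rw [← hG.pd_scalar hy, ← hG.divergence_ricci hy]
    congr 1
    exact Finset.sum_congr rfl fun j _ => Finset.sum_congr rfl fun k _ => by
      rw [hG.covMat_ricciMat_symm hy]
  have h2 : ∑ j, ∑ k, (G y)⁻¹ j k *
      (covMat G (ricciMat G) i y j k - covMat G (ricciMat G) j y i k)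
      = ∑ a, ricci G y i a * v a := by
    simp only [hG.covMat_ricciMat_sub_of_soliton hy hF hsol hv, ricci, Finset.mul_sum,
      Finset.sum_mul]
    symm
    rw [Finset.sum_comm]
    refine Finset.sum_congr rfl fun j _ => ?_
    rw [Finset.sum_comm]
    exact Finset.sum_congr rfl fun k _ => Finset.sum_congr rfl fun a _ => by ring
  linarith

/-- The divergence of the Weyl tensor of a gradient Ricci soliton, free of derivatives. -/
theorem divergence_weyl_of_soliton (hG : IsMetricOn G U) (hy : y ∈ U) (hF : ContDiffAt ℝ ∞ F y)
    (hsol : ∀ z ∈ U, ∀ i j, ricci G z i j + hessian G F z i j = lam * G z i j)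
    (hv : ∀ h, pd h F y = ∑ a, G y h a * v a) (j k l : Fin 4) :
    divergence G (weyl G) y j k l = 1 / 2 * ∑ a, riemann G y k l a j * v a
      - 1 / 6 * ((∑ a, ricci G y k a * v a) * G y j l - (∑ a, ricci G y l a * v a) * G y j k) := by
  rw [hG.divergence_weyl hy, hG.covMat_ricciMat_sub_of_soliton hy hF hsol hv,
    hG.pd_scalar_of_soliton hy hF hsol hv, hG.pd_scalar_of_soliton hy hF hsol hv]
  ring

end IsMetricOn

end

/-! ### The Levi-Civita symbol -/

section

section Rows

variable {n : Type*} [Fintype n] [DecidableEq n]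

theorem det_updateRow_eq_sum (A : Matrix n n ℝ) (i : n) (b : n → ℝ) :
    (A.updateRow i b).det = ∑ j, b j * (A.updateRow i (Pi.single j 1)).det := by
  simp only [← Matrix.cramer_transpose_apply]
  simp only [Matrix.cramer_eq_adjugate_mulVec, Matrix.mulVec_single_one, Matrix.col_apply]
  exact Finset.sum_congr rfl fun j _ => mul_comm _ _

/-- The derivative of `det (A * exp (t B))` at `t = 0`, computed row by row. -/
theorem sum_det_updateRow_mul (A B : Matrix n n ℝ) :
    ∑ r, (A.updateRow r ((A * B) r)).det = B.trace * A.det := by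
  have h : ∀ r, (A.updateRow r ((A * B) r)).det = (A * B * A.adjugate) r r := by
    intro r
    rw [det_updateRow_eq_sum, Matrix.mul_apply]
    simp only [Matrix.adjugate_apply]
  simp only [h]
  change (A * B * A.adjugate).trace = _
  rw [Matrix.trace_mul_comm, ← Matrix.mul_assoc, Matrix.adjugate_mul, Matrix.smul_mul,
    Matrix.one_mul, Matrix.trace_smul, smul_eq_mul, mul_comm]

end Rows

theorem leviCivitaSymbol_eq_det (i j k l : Fin 4) : leviCivitaSymbol i j k l
    = (Matrix.of ![Pi.single i 1, Pi.single j 1, Pi.single k 1, Pi.single l (1 : ℝ)]).det := by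
  rw [leviCivitaSymbol]
  congr 1
  ext a b
  fin_cases a <;> simp [Pi.single_apply, eq_comm]

theorem updateRow_zero (v w x z b : Fin 4 → ℝ) :
    (Matrix.of ![v, w, x, z]).updateRow 0 b = Matrix.of ![b, w, x, z] := by
  ext r c; fin_cases r <;> simp [Matrix.updateRow_apply]

theorem updateRow_one (v w x z b : Fin 4 → ℝ) :
    (Matrix.of ![v, w, x, z]).updateRow 1 b = Matrix.of ![v, b, x, z] := by
  ext r c; fin_cases r <;> simp [Matrix.updateRow_apply]

theorem updateRow_two (v w x z b : Fin 4 → ℝ) :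
    (Matrix.of ![v, w, x, z]).updateRow 2 b = Matrix.of ![v, w, b, z] := by
  ext r c; fin_cases r <;> simp [Matrix.updateRow_apply]

theorem updateRow_three (v w x z b : Fin 4 → ℝ) :
    (Matrix.of ![v, w, x, z]).updateRow 3 b = Matrix.of ![v, w, x, b] := by
  ext r c; fin_cases r <;> simp [Matrix.updateRow_apply]

theorem det_rows_eq_sum (v w x z : Fin 4 → ℝ) :
    (Matrix.of ![v, w, x, z]).det
      = ∑ a, ∑ b, ∑ c, ∑ d, v a * w b * x c * z d * leviCivitaSymbol a b c d := by
  rw [← updateRow_zero v, det_updateRow_eq_sum]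
  refine Finset.sum_congr rfl fun a _ => ?_
  rw [updateRow_zero, ← updateRow_one _ w, det_updateRow_eq_sum, Finset.mul_sum]
  refine Finset.sum_congr rfl fun b _ => ?_
  rw [updateRow_one, ← updateRow_two _ _ x, det_updateRow_eq_sum, Finset.mul_sum, Finset.mul_sum]
  refine Finset.sum_congr rfl fun c _ => ?_
  rw [updateRow_two, ← updateRow_three _ _ _ z, det_updateRow_eq_sum, Finset.mul_sum,
    Finset.mul_sum, Finset.mul_sum]
  refine Finset.sum_congr rfl fun d _ => ?_
  rw [updateRow_three, leviCivitaSymbol_eq_det]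
  ring

/-- The Levi-Civita symbol as a matrix indexed by pairs of indices. -/
def leviMat : Matrix (Fin 4 × Fin 4) (Fin 4 × Fin 4) ℝ :=
  Matrix.of fun p q => leviCivitaSymbol p.1 p.2 q.1 q.2

/-- The Levi-Civita symbol transforms under a change of frame by the determinant. -/
theorem kronecker_mul_leviMat (E : Matrix (Fin 4) (Fin 4) ℝ) :
    (E ⊗ₖ E)ᵀ * leviMat * (E ⊗ₖ E) = E.det • leviMat := by
  ext ⟨i, j⟩ ⟨k, l⟩
  have h : E.det * leviCivitaSymbol i j k l
      = (Matrix.of ![fun a => E a i, fun a => E a j, fun a => E a k, fun a => E a l]).det := by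
    rw [leviCivitaSymbol_eq_det, ← Matrix.det_transpose E, mul_comm, ← Matrix.det_mul]
    congr 1
    ext r c
    fin_cases r <;> simp [Matrix.mul_apply, Pi.single_apply]
  rw [Matrix.smul_apply, smul_eq_mul, leviMat, Matrix.of_apply, h, det_rows_eq_sum]
  simp only [Matrix.mul_apply, Fintype.sum_prod_type, Matrix.transpose_apply,
    Matrix.kroneckerMap_apply, Matrix.of_apply, Finset.sum_mul]
  calc _ = ∑ c, ∑ d, ∑ a, ∑ b, E a i * E b j * E c k * E d l * leviCivitaSymbol a b c d :=
        Finset.sum_congr rfl fun c _ => Finset.sum_congr rfl fun d _ =>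
          Finset.sum_congr rfl fun a _ => Finset.sum_congr rfl fun b _ => by ring
    _ = ∑ c, ∑ a, ∑ d, ∑ b, E a i * E b j * E c k * E d l * leviCivitaSymbol a b c d :=
        Finset.sum_congr rfl fun c _ => Finset.sum_comm
    _ = ∑ a, ∑ c, ∑ b, ∑ d, E a i * E b j * E c k * E d l * leviCivitaSymbol a b c d := by
        rw [Finset.sum_comm]
        exact Finset.sum_congr rfl fun a _ => Finset.sum_congr rfl fun c _ => Finset.sum_comm
    _ = _ := Finset.sum_congr rfl fun a _ => Finset.sum_comm

/-- The action of `A` on tensors with two upper indices, by derivations. -/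
def pairAct (A : Matrix (Fin 4) (Fin 4) ℝ) : Matrix (Fin 4 × Fin 4) (Fin 4 × Fin 4) ℝ :=
  A ⊗ₖ 1 + 1 ⊗ₖ A

/-- The infinitesimal form of `kronecker_mul_leviMat`. -/
theorem pairAct_leviMat (A : Matrix (Fin 4) (Fin 4) ℝ) :
    (pairAct A)ᵀ * leviMat + leviMat * pairAct A = A.trace • leviMat := by
  ext ⟨i, j⟩ ⟨k, l⟩
  let M : Matrix (Fin 4) (Fin 4) ℝ :=
    Matrix.of ![Pi.single i 1, Pi.single j 1, Pi.single k 1, Pi.single l (1 : ℝ)]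
  have h := sum_det_updateRow_mul M Aᵀ
  rw [Matrix.trace_transpose, ← leviCivitaSymbol_eq_det i j k l, Fin.sum_univ_four,
    det_updateRow_eq_sum, det_updateRow_eq_sum, det_updateRow_eq_sum, det_updateRow_eq_sum] at h
  simp only [M, updateRow_zero, updateRow_one, updateRow_two, updateRow_three,
    ← leviCivitaSymbol_eq_det] at h
  rw [Matrix.smul_apply, smul_eq_mul, leviMat, Matrix.of_apply, ← h]
  simp [pairAct, Matrix.mul_apply, Fintype.sum_prod_type, Matrix.one_apply, Pi.single_apply,
    add_mul, mul_add]
  simp only [mul_comm, add_assoc]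

end

/-! ### The Hodge star as a matrix on pairs of indices -/

section

variable {G : E4 → Matrix (Fin 4) (Fin 4) ℝ} {U : Set E4} {y : E4} {s : E4 → ℝ}

/-- A tensor with four lower indices as a matrix indexed by pairs of indices. -/
def pairMat (T : Fin 4 → Fin 4 → Fin 4 → Fin 4 → ℝ) :
    Matrix (Fin 4 × Fin 4) (Fin 4 × Fin 4) ℝ :=
  Matrix.of fun p q => T p.1 p.2 q.1 q.2

/-- The matrix `½ vol_{ijcd} g^{ca} g^{db}` of the Hodge star on pairs of indices. -/
def starMat (G : E4 → Matrix (Fin 4) (Fin 4) ℝ) (s : E4 → ℝ) (y : E4) :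
    Matrix (Fin 4 × Fin 4) (Fin 4 × Fin 4) ℝ :=
  (1 / 2 * (s y * Real.sqrt (G y).det)) • (leviMat * ((G y)⁻¹ ⊗ₖ (G y)⁻¹))

theorem starMat_apply (i j a b : Fin 4) : starMat G s y (i, j) (a, b)
    = (1 / 2) * ∑ c, ∑ d, volumeForm G s y i j c d * (G y)⁻¹ c a * (G y)⁻¹ d b := by
  simp only [starMat, leviMat, volumeForm, Matrix.smul_apply, Matrix.mul_apply, smul_eq_mul,
    Fintype.sum_prod_type, Matrix.kroneckerMap_apply, Matrix.of_apply, Finset.mul_sum]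
  exact Finset.sum_congr rfl fun c _ => Finset.sum_congr rfl fun d _ => by ring

theorem pairMat_starLeft (T : Tensor4) :
    pairMat (starLeft G s T y) = starMat G s y * pairMat (T y) := by
  ext ⟨i, j⟩ ⟨k, l⟩
  simp only [pairMat, Matrix.mul_apply, Fintype.sum_prod_type, starMat_apply, starLeft,
    Matrix.of_apply, Finset.mul_sum, Finset.sum_mul]
  exact Finset.sum_congr rfl fun a _ => Finset.sum_congr rfl fun b _ =>
    Finset.sum_congr rfl fun c _ => Finset.sum_congr rfl fun d _ => by ring

theorem pairMat_starRight (T : Tensor4) :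
    pairMat (starRight G s T y) = pairMat (T y) * (starMat G s y)ᵀ := by
  ext ⟨i, j⟩ ⟨k, l⟩
  simp only [pairMat, Matrix.mul_apply, Fintype.sum_prod_type, starMat_apply, starRight,
    Matrix.of_apply, Finset.mul_sum, Matrix.transpose_apply]
  exact Finset.sum_congr rfl fun a _ => Finset.sum_congr rfl fun b _ =>
    Finset.sum_congr rfl fun c _ => Finset.sum_congr rfl fun d _ => by ring

theorem pairMat_dualPart (ε : ℤˣ) (T : Tensor4) :
    pairMat (dualPart G s ε T y) = (1 / 4 : ℝ) • (pairMat (T y)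
      + ((ε : ℤ) : ℝ) • (pairMat (T y) * (starMat G s y)ᵀ)
      + ((ε : ℤ) : ℝ) • (starMat G s y * pairMat (T y))
      + starMat G s y * (pairMat (T y) * (starMat G s y)ᵀ)) := by
  rw [← pairMat_starRight, ← pairMat_starLeft, ← pairMat_starLeft]
  rfl

/-- The covariant derivative `∇ₘT = ∂ₘT - Lᵀ T - T L` of a tensor with four lower indices, where
`L` is the action of the connection matrix on pairs. -/
theorem pairMat_covDeriv (T : Tensor4) (m : Fin 4) :
    pairMat (covDeriv G T y m) = pdMat m (fun z => pairMat (T z)) y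
      - (pairAct (connMat G m y))ᵀ * pairMat (T y) - pairMat (T y) * pairAct (connMat G m y) := by
  ext ⟨i, j⟩ ⟨k, l⟩
  simp only [pairMat, covDeriv, Matrix.sub_apply, Matrix.mul_apply, Fintype.sum_prod_type,
    pairAct, Matrix.of_apply, Matrix.transpose_apply, Matrix.add_apply,
    Matrix.kroneckerMap_apply, Matrix.one_apply, pdMat, connMat, add_mul, mul_add,
    Finset.sum_add_distrib]
  simp [mul_comm]
  ring

theorem pdMat_kronecker {A B : E4 → Matrix (Fin 4) (Fin 4) ℝ} (hA : SmoothMatAt A y)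
    (hB : SmoothMatAt B y) (m : Fin 4) :
    pdMat m (fun z => A z ⊗ₖ B z) y = pdMat m A y ⊗ₖ B y + A y ⊗ₖ pdMat m B y := by
  ext ⟨i, j⟩ ⟨k, l⟩
  exact pd_mul (hA.diff i k) (hB.diff j l) m

/-- `s` is a locally constant sign on `U`. -/
structure IsLocalSign (s : E4 → ℝ) (U : Set E4) : Prop where
  eventuallyEq : ∀ y ∈ U, s =ᶠ[𝓝 y] fun _ => s y
  sq_eq_one : ∀ y, s y ^ 2 = 1

namespace IsMetricOn

/-- The volume density satisfies `∂ₘ √det g = tr Γₘ √det g`. -/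
theorem pd_sqrt_det (hG : IsMetricOn G U) (hy : y ∈ U) (m : Fin 4) :
    ContDiffAt ℝ ∞ (fun z => Real.sqrt (G z).det) y ∧
    pd m (fun z => Real.sqrt (G z).det) y
      = (connMat G m y).trace * Real.sqrt (G y).det := by
  have hs := hG.smooth y hy
  have hc : ContDiffAt ℝ ∞ (fun z => Real.sqrt (G z).det) y := hs.det.sqrt (hG.det_pos hy).ne'
  refine ⟨hc, ?_⟩
  have hd := differentiableAt_of_contDiffAt hc
  have h1 : pd m (fun z => (G z).det) y
      = 2 * (Real.sqrt (G y).det * pd m (fun z => Real.sqrt (G z).det) y) := by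
    have : (fun z => (G z).det) =ᶠ[𝓝 y] fun z => Real.sqrt (G z).det * Real.sqrt (G z).det := by
      filter_upwards [hG.mem_nhds hy] with z hz
      exact (Real.mul_self_sqrt (hG.det_pos hz).le).symm
    rw [pd_congr this, pd_mul hd hd]
    ring
  have h2 : pd m (fun z => (G z).det) y = 2 * ((connMat G m y).trace * (G y).det) := by
    rw [pd_det hs, hG.pdMat_metric hy, Matrix.mul_add, Matrix.trace_add,
      ← Matrix.mul_assoc _ (G y), Matrix.adjugate_mul, Matrix.smul_mul, Matrix.one_mul,
      Matrix.trace_mul_comm _ (_ * G y), Matrix.mul_assoc, Matrix.mul_adjugate, Matrix.mul_smul,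
      Matrix.mul_one, Matrix.trace_smul, Matrix.trace_smul, Matrix.trace_transpose, smul_eq_mul]
    ring
  have hpos := Real.sqrt_pos.2 (hG.det_pos hy)
  have h3 := Real.mul_self_sqrt (hG.det_pos hy).le
  refine mul_left_cancel₀ hpos.ne' ?_
  rw [h2] at h1
  linear_combination (-1 / 2) * h1 + (-(connMat G m y).trace) * h3

theorem smooth_starMat (hG : IsMetricOn G U) (hs : IsLocalSign s U) (hy : y ∈ U) :
    SmoothMatAt (starMat G s) y := by
  rintro ⟨i, j⟩ ⟨k, l⟩
  have h : ContDiffAt ℝ ∞ s y := contDiffAt_const.congr_of_eventuallyEq (hs.eventuallyEq y hy)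
  have hK : SmoothMatAt (fun z => leviMat * ((G z)⁻¹ ⊗ₖ (G z)⁻¹)) y :=
    SmoothMatAt.mul (A := fun _ => leviMat) (fun _ _ => contDiffAt_const)
      fun p q => (hG.smooth_inv hy p.1 q.1).mul (hG.smooth_inv hy p.2 q.2)
  exact (contDiffAt_const.mul (h.mul (hG.pd_sqrt_det hy 0).1)).mul (hK (i, j) (k, l))

/-- The Hodge star is parallel. -/
theorem pdMat_starMat (hG : IsMetricOn G U) (hs : IsLocalSign s U) (hy : y ∈ U) (m : Fin 4) :
    pdMat m (starMat G s) y = (pairAct (connMat G m y))ᵀ * starMat G s y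
      - starMat G s y * (pairAct (connMat G m y))ᵀ := by
  have hi := hG.smooth_inv hy
  obtain ⟨hc, hd⟩ := hG.pd_sqrt_det hy m
  have hK : SmoothMatAt (fun z => (G z)⁻¹ ⊗ₖ (G z)⁻¹) y :=
    fun p q => (hi p.1 q.1).mul (hi p.2 q.2)
  have hlevi : SmoothMatAt (fun _ => leviMat) y := fun _ _ => contDiffAt_const
  have hlevi0 : pdMat m (fun _ => leviMat) y = 0 := by
    ext a b
    exact pd_const m _ y
  have h1 : pdMat m (starMat G s) y = (1 / 2 * (s y * Real.sqrt (G y).det)) •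
      ((connMat G m y).trace • (leviMat * ((G y)⁻¹ ⊗ₖ (G y)⁻¹))
        + leviMat * pdMat m (fun z => (G z)⁻¹ ⊗ₖ (G z)⁻¹) y) := by
    have h2 : pdMat m (fun z => leviMat * ((G z)⁻¹ ⊗ₖ (G z)⁻¹)) y
        = leviMat * pdMat m (fun z => (G z)⁻¹ ⊗ₖ (G z)⁻¹) y := by
      rw [pdMat_mul hlevi hK, hlevi0, Matrix.zero_mul, zero_add]
    rw [← h2]
    ext p q
    have h3 : (fun z => starMat G s z p q) =ᶠ[𝓝 y] fun z => (1 / 2 * s y) *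
        (Real.sqrt (G z).det * (leviMat * ((G z)⁻¹ ⊗ₖ (G z)⁻¹)) p q) := by
      filter_upwards [hs.eventuallyEq y hy] with z hz
      rw [starMat, hz, Matrix.smul_apply, smul_eq_mul]
      ring
    have hd' := differentiableAt_of_contDiffAt hc
    rw [pdMat, Matrix.of_apply, pd_congr h3, pd_const_mul (hd'.fun_mul ((hlevi.mul hK).diff p q)),
      pd_mul hd' ((hlevi.mul hK).diff p q), hd]
    simp only [Matrix.smul_apply, Matrix.add_apply, smul_eq_mul, pdMat, Matrix.of_apply]
    ring
  have h4 : pdMat m (fun z => (G z)⁻¹ ⊗ₖ (G z)⁻¹) y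
      = -(pairAct (connMat G m y) * ((G y)⁻¹ ⊗ₖ (G y)⁻¹))
        - ((G y)⁻¹ ⊗ₖ (G y)⁻¹) * (pairAct (connMat G m y))ᵀ := by
    rw [pdMat_kronecker hi hi, hG.pdMat_inv hy]
    simp only [pairAct, Matrix.transpose_add, ← Matrix.kroneckerMap_transpose,
      Matrix.transpose_one, Matrix.add_mul, Matrix.mul_add, ← Matrix.mul_kronecker_mul,
      Matrix.one_mul, Matrix.mul_one, sub_eq_add_neg, Matrix.add_kronecker, Matrix.kronecker_add]
    simp only [← neg_one_smul ℝ (_ : Matrix (Fin 4) (Fin 4) ℝ), Matrix.smul_kronecker,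
      Matrix.kronecker_smul]
    module
  rw [h1, h4, starMat, ← Matrix.smul_mul, ← pairAct_leviMat]
  simp only [Matrix.mul_smul, Matrix.smul_mul, ← smul_sub]
  congr 1
  simp only [Matrix.mul_sub, Matrix.mul_neg, Matrix.add_mul, Matrix.mul_assoc]
  abel

/-- As the Hodge star is parallel, covariant differentiation commutes with it. -/
theorem covDeriv_starRight (hG : IsMetricOn G U) (hs : IsLocalSign s U) (hy : y ∈ U)
    {T : Tensor4} (hT : SmoothMatAt (fun z => pairMat (T z)) y) (m : Fin 4) :
    pairMat (covDeriv G (starRight G s T) y m)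
      = pairMat (covDeriv G T y m) * (starMat G s y)ᵀ := by
  simp only [pairMat_covDeriv, pairMat_starRight]
  rw [pdMat_mul hT (hG.smooth_starMat hs hy).transpose, pdMat_transpose,
    hG.pdMat_starMat hs hy]
  simp only [Matrix.transpose_sub, Matrix.transpose_mul, Matrix.transpose_transpose,
    Matrix.mul_sub, Matrix.sub_mul, Matrix.mul_assoc]
  abel

end IsMetricOn

end

/-! ### Self-duality in an orthonormal frame -/

section

/-- The Levi-Civita symbol in closed form, as a Vandermonde product divided by its value `12` on
the identity permutation. -/
def leviInt (i j k l : Fin 4) : ℤ :=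
  (j.val - i.val : ℤ) * (k.val - i.val) * (l.val - i.val) * (k.val - j.val) * (l.val - j.val)
    * (l.val - k.val) / 12

theorem leviCivitaSymbol_eq_leviInt (i j k l : Fin 4) :
    leviCivitaSymbol i j k l = (leviInt i j k l : ℝ) := by
  have h : (Matrix.of fun a b : Fin 4 => if ![i, j, k, l] a = b then (1 : ℤ) else 0).det
      = leviInt i j k l := by
    simp only [Matrix.det_succ_row_zero, Fin.sum_univ_succ, Matrix.of_apply,
      Matrix.submatrix_apply, Matrix.det_fin_zero, Finset.univ_eq_empty, Finset.sum_empty]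
    revert i j k l
    decide +kernel
  rw [← h, leviCivitaSymbol, Int.cast_det]
  congr 1
  ext a b
  simp

theorem leviMat_transpose : leviMatᵀ = leviMat := by
  ext ⟨i, j⟩ ⟨k, l⟩
  simp only [leviMat, Matrix.transpose_apply, Matrix.of_apply, leviCivitaSymbol_eq_leviInt]
  have : ∀ i j k l, leviInt k l i j = leviInt i j k l := by decide +kernel
  rw [this]

/-- The Hodge dual `f_{i'j'}` of a two-form in a positively oriented orthonormal frame. -/
def hodgeDual (f : Fin 4 → Fin 4 → ℝ) (i j : Fin 4) : ℝ :=
  ![![0, f 2 3, f 3 1, f 1 2], ![f 3 2, 0, f 0 3, f 2 0], ![f 1 3, f 3 0, 0, f 0 1],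
    ![f 2 1, f 0 2, f 1 0, 0]] i j

theorem sum_leviCivitaSymbol_mul {f : Fin 4 → Fin 4 → ℝ} (hf : ∀ i j, f j i = -f i j)
    (i j : Fin 4) :
    1 / 2 * ∑ c, ∑ d, leviCivitaSymbol i j c d * f c d = hodgeDual f i j := by
  simp only [leviCivitaSymbol_eq_leviInt]
  fin_cases i <;> fin_cases j <;> simp [Fin.sum_univ_four, leviInt, hodgeDual] <;>
    linarith [hf 2 3, hf 1 3, hf 1 2, hf 0 3, hf 0 2, hf 0 1]

theorem hodgeDual_antisymm {f : Fin 4 → Fin 4 → ℝ} (hf : ∀ i j, f j i = -f i j) (i j : Fin 4) :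
    hodgeDual f j i = -hodgeDual f i j := by
  fin_cases i <;> fin_cases j <;> simp [hodgeDual, hf 2 3, hf 1 3, hf 1 2, hf 0 3, hf 0 2, hf 0 1]

theorem hodgeDual_neg {f h : Fin 4 → Fin 4 → ℝ} (hfh : ∀ i j, f i j = -h i j) (i j : Fin 4) :
    hodgeDual f i j = -hodgeDual h i j := by
  fin_cases i <;> fin_cases j <;> simp [hodgeDual, hfh]

/-- The smaller index of each of the six pairs `i < j`. -/
def pairFst : Fin 6 → Fin 4 := ![0, 0, 0, 1, 1, 2]

/-- The larger index of each of the six pairs `i < j`. -/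
def pairSnd : Fin 6 → Fin 4 := ![1, 2, 3, 2, 3, 3]

/-- Antisymmetric functions of two indices agree once they agree on the six pairs `i < j`. -/
theorem eq_of_antisymm {f h : Fin 4 → Fin 4 → ℝ} (hf : ∀ i j, f j i = -f i j)
    (hh : ∀ i j, h j i = -h i j) (H : ∀ r, f (pairFst r) (pairSnd r) = h (pairFst r) (pairSnd r))
    (i j : Fin 4) : f i j = h i j := by
  have e : ∀ i, f i i = h i i := fun i => by linarith [hf i i, hh i i]
  have h01 : f 0 1 = h 0 1 := H 0
  have h02 : f 0 2 = h 0 2 := H 1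
  have h03 : f 0 3 = h 0 3 := H 2
  have h12 : f 1 2 = h 1 2 := H 3
  have h13 : f 1 3 = h 1 3 := H 4
  have h23 : f 2 3 = h 2 3 := H 5
  fin_cases i <;> fin_cases j <;>
    simp [e, hf 0 1, hf 0 2, hf 0 3, hf 1 2, hf 1 3, hf 2 3, hh 0 1, hh 0 2, hh 0 3, hh 1 2,
      hh 1 3, hh 2 3, h01, h02, h03, h12, h13, h23]

/-- The matrix of the Hodge star on pairs of indices in a positively oriented orthonormal frame. -/
def flatStar : Matrix (Fin 4 × Fin 4) (Fin 4 × Fin 4) ℝ := (1 / 2 : ℝ) • leviMat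

theorem flatStar_transpose : flatStarᵀ = flatStar := by
  rw [flatStar, Matrix.transpose_smul, leviMat_transpose]

theorem flatStar_mul_pairMat {T : Fin 4 → Fin 4 → Fin 4 → Fin 4 → ℝ}
    (hT : ∀ i j k l, T j i k l = -T i j k l) :
    flatStar * pairMat T = pairMat fun i j k l => hodgeDual (fun c d => T c d k l) i j := by
  ext ⟨i, j⟩ ⟨k, l⟩
  simp only [pairMat, Matrix.of_apply]
  rw [← sum_leviCivitaSymbol_mul fun i j => hT i j k l]
  simp only [flatStar, leviMat, Matrix.smul_apply, Matrix.mul_apply, Fintype.sum_prod_type,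
    smul_eq_mul, Matrix.of_apply, Finset.mul_sum, mul_assoc]

theorem mul_flatStar_apply {m : Type*} {X : Matrix m (Fin 4 × Fin 4) ℝ} {p : m}
    (hX : ∀ i j, X p (j, i) = -X p (i, j)) (k l : Fin 4) :
    (X * flatStar) p (k, l) = hodgeDual (fun c d => X p (c, d)) k l := by
  rw [← sum_leviCivitaSymbol_mul hX, ← flatStar_transpose]
  simp only [flatStar, leviMat, Matrix.smul_apply, Matrix.mul_apply, Matrix.transpose_apply,
    Fintype.sum_prod_type, smul_eq_mul, Matrix.of_apply, Finset.mul_sum]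
  exact Finset.sum_congr rfl fun c _ => Finset.sum_congr rfl fun d _ => by ring

theorem pairMat_mul_flatStar {T : Fin 4 → Fin 4 → Fin 4 → Fin 4 → ℝ}
    (hT : ∀ i j k l, T i j l k = -T i j k l) :
    pairMat T * flatStar = pairMat fun i j => hodgeDual (T i j) := by
  ext ⟨i, j⟩ ⟨k, l⟩
  exact mul_flatStar_apply (X := pairMat T) (p := (i, j)) (fun c d => hT i j c d) k l

/-- The Ricci tensor of `T` in an orthonormal frame. -/
def flatRicci (T : Fin 4 → Fin 4 → Fin 4 → Fin 4 → ℝ) (a c : Fin 4) : ℝ := ∑ b, T a b c b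

/-- The scalar curvature of `T` in an orthonormal frame. -/
def flatScalar (T : Fin 4 → Fin 4 → Fin 4 → Fin 4 → ℝ) : ℝ := ∑ a, flatRicci T a a

/-- The Weyl tensor of `T` in an orthonormal frame. -/
def flatWeyl (T : Fin 4 → Fin 4 → Fin 4 → Fin 4 → ℝ) (i j k l : Fin 4) : ℝ :=
  T i j k l
    - (1 / 2) * (flatRicci T i k * (1 : Matrix (Fin 4) (Fin 4) ℝ) j l
        + flatRicci T j l * (1 : Matrix (Fin 4) (Fin 4) ℝ) i k
        - flatRicci T i l * (1 : Matrix (Fin 4) (Fin 4) ℝ) j k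
        - flatRicci T j k * (1 : Matrix (Fin 4) (Fin 4) ℝ) i l)
    + flatScalar T / 6 * ((1 : Matrix (Fin 4) (Fin 4) ℝ) i k * (1 : Matrix (Fin 4) (Fin 4) ℝ) j l
        - (1 : Matrix (Fin 4) (Fin 4) ℝ) i l * (1 : Matrix (Fin 4) (Fin 4) ℝ) j k)

variable {T : Fin 4 → Fin 4 → Fin 4 → Fin 4 → ℝ}

theorem flatRicci_symm (hT : IsCurvatureLike T) (a c : Fin 4) :
    flatRicci T a c = flatRicci T c a :=
  Finset.sum_congr rfl fun b _ => hT.pair_symm a b c b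

theorem flatWeyl_isCurvatureLike (hT : IsCurvatureLike T) : IsCurvatureLike (flatWeyl T) where
  antisymm_left i j k l := by simp only [flatWeyl, hT.antisymm_left i j k l]; ring
  antisymm_right i j k l := by simp only [flatWeyl, hT.antisymm_right i j k l]; ring
  bianchi i j k l := by
    have h1 : ∀ a b, (1 : Matrix (Fin 4) (Fin 4) ℝ) a b = (1 : Matrix (Fin 4) (Fin 4) ℝ) b a :=
      fun a b => by simp only [Matrix.one_apply, eq_comm]
    simp only [flatWeyl]
    rw [h1 k j, h1 k i, h1 j i, flatRicci_symm hT k j, flatRicci_symm hT k i,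
      flatRicci_symm hT j i]
    linear_combination hT.bianchi i j k l

theorem flatRicci_flatWeyl (a c : Fin 4) : flatRicci (flatWeyl T) a c = 0 := by
  have h1 : ∑ b, flatRicci T a c * (1 : Matrix (Fin 4) (Fin 4) ℝ) b b = 4 * flatRicci T a c := by
    simp only [Matrix.one_apply_eq, Fin.sum_univ_four]; ring
  have h2 : ∑ b, flatRicci T b b * (1 : Matrix (Fin 4) (Fin 4) ℝ) a c
      = flatScalar T * (1 : Matrix (Fin 4) (Fin 4) ℝ) a c := by
    rw [flatScalar, Finset.sum_mul]
  have h3 : ∑ b, flatRicci T a b * (1 : Matrix (Fin 4) (Fin 4) ℝ) b c = flatRicci T a c := by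
    simp [Matrix.one_apply]
  have h4 : ∑ b, flatRicci T b c * (1 : Matrix (Fin 4) (Fin 4) ℝ) a b = flatRicci T a c := by
    simp [Matrix.one_apply]
  have h5 : ∑ b : Fin 4, (1 : Matrix (Fin 4) (Fin 4) ℝ) a c * (1 : Matrix (Fin 4) (Fin 4) ℝ) b b
      = 4 * (1 : Matrix (Fin 4) (Fin 4) ℝ) a c := by
    simp only [Matrix.one_apply_eq, Fin.sum_univ_four]; ring
  have h6 : ∑ b : Fin 4, (1 : Matrix (Fin 4) (Fin 4) ℝ) a b * (1 : Matrix (Fin 4) (Fin 4) ℝ) b c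
      = (1 : Matrix (Fin 4) (Fin 4) ℝ) a c := by
    rw [← Matrix.mul_apply, Matrix.mul_one]
  rw [flatRicci]
  simp only [flatWeyl, Finset.sum_add_distrib, Finset.sum_sub_distrib, ← Finset.mul_sum, h1, h2,
    h3, h4, h5, h6]
  rw [← flatRicci]
  ring

/-- In dimension four a trace-free algebraic curvature tensor commutes with the Hodge star. -/
theorem hodgeDual_comm (hT : IsCurvatureLike T) (h0 : ∀ a c, flatRicci T a c = 0)
    (i j k l : Fin 4) :
    hodgeDual (fun c d => T c d k l) i j = hodgeDual (T i j) k l := by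
  have tL := hT.antisymm_left
  have tR := hT.antisymm_right
  have tz : ∀ i k l, T i i k l = 0 := fun i k l => by linarith [tL i i k l]
  have tz' : ∀ i j k, T i j k k = 0 := fun i j k => by linarith [tR i j k k]
  simp only [flatRicci, Fin.sum_univ_four] at h0
  have L10 := tL 0 1
  have L20 := tL 0 2
  have L30 := tL 0 3
  have L21 := tL 1 2
  have L31 := tL 1 3
  have L32 := tL 2 3
  have R10 : ∀ i j, T i j 1 0 = -T i j 0 1 := fun i j => tR i j 0 1
  have R20 : ∀ i j, T i j 2 0 = -T i j 0 2 := fun i j => tR i j 0 2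
  have R30 : ∀ i j, T i j 3 0 = -T i j 0 3 := fun i j => tR i j 0 3
  have R21 : ∀ i j, T i j 2 1 = -T i j 1 2 := fun i j => tR i j 1 2
  have R31 : ∀ i j, T i j 3 1 = -T i j 1 3 := fun i j => tR i j 1 3
  have R32 : ∀ i j, T i j 3 2 = -T i j 2 3 := fun i j => tR i j 2 3
  have P := hT.pair_symm
  have P1 := P 0 1 0 2
  have P2 := P 0 1 0 3
  have P3 := P 0 1 1 2
  have P4 := P 0 1 1 3
  have P5 := P 0 1 2 3
  have P6 := P 0 2 0 3
  have P7 := P 0 2 1 2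
  have P8 := P 0 2 1 3
  have P9 := P 0 2 2 3
  have P10 := P 0 3 1 2
  have P11 := P 0 3 1 3
  have P12 := P 0 3 2 3
  have P13 := P 1 2 1 3
  have P14 := P 1 2 2 3
  have P15 := P 1 3 2 3
  have t00 := h0 0 0
  have t01 := h0 0 1
  have t02 := h0 0 2
  have t03 := h0 0 3
  have t11 := h0 1 1
  have t12 := h0 1 2
  have t13 := h0 1 3
  have t22 := h0 2 2
  have t23 := h0 2 3
  have t33 := h0 3 3
  revert i j
  suffices H : ∀ r k l, hodgeDual (fun c d => T c d k l) (pairFst r) (pairSnd r)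
      = hodgeDual (T (pairFst r) (pairSnd r)) k l from fun i j =>
    eq_of_antisymm (f := fun i j => hodgeDual (fun c d => T c d k l) i j)
      (h := fun i j => hodgeDual (T i j) k l)
      (fun i j => hodgeDual_antisymm (fun i j => tL i j k l) i j)
      (fun i j => hodgeDual_neg (tL i j) k l) (fun r => H r k l) i j
  intro r k l
  refine eq_of_antisymm (f := fun k l => hodgeDual (fun c d => T c d k l) (pairFst r) (pairSnd r))
    (h := fun k l => hodgeDual (T (pairFst r) (pairSnd r)) k l)
    (fun k l => hodgeDual_neg (fun c d => tR c d k l) _ _)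
    (fun k l => hodgeDual_antisymm (tR _ _) k l) (fun t => ?_) k l
  clear hT tL tR h0 P
  simp only [tz, tz', L10, L20, L30, L21, L31, L32, R10, R20, R30, R21, R31, R32]
    at t00 t01 t02 t03 t11 t12 t13 t22 t23 t33
  fin_cases r <;> fin_cases t <;>
    simp only [hodgeDual, pairFst, pairSnd, Fin.zero_eta, Fin.mk_one, Fin.reduceFinMk,
      Matrix.cons_val, L10, L20, L30, L21, L31, L32, R10, R20, R30, R21, R31, R32] <;>
    linarith

theorem hodgeDual_hodgeDual {f : Fin 4 → Fin 4 → ℝ} (hf : ∀ i j, f j i = -f i j)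
    (i j : Fin 4) : hodgeDual (hodgeDual f) i j = f i j := by
  have e : ∀ i, f i i = 0 := fun i => by linarith [hf i i]
  fin_cases i <;> fin_cases j <;> simp [hodgeDual, e]

theorem flatStar_mul_flatWeyl (hT : IsCurvatureLike T) :
    flatStar * pairMat (flatWeyl T) = pairMat (flatWeyl T) * flatStar := by
  have hW := flatWeyl_isCurvatureLike hT
  rw [flatStar_mul_pairMat hW.antisymm_left, pairMat_mul_flatStar hW.antisymm_right]
  congr 1
  funext i j k l
  exact hodgeDual_comm hW flatRicci_flatWeyl i j k l

theorem flatStar_mul_flatWeyl_mul_flatStar (hT : IsCurvatureLike T) :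
    flatStar * pairMat (flatWeyl T) * flatStar = pairMat (flatWeyl T) := by
  have hW := flatWeyl_isCurvatureLike hT
  rw [flatStar_mul_flatWeyl hT, pairMat_mul_flatStar hW.antisymm_right,
    pairMat_mul_flatStar fun i j k l => hodgeDual_antisymm (hW.antisymm_right i j) k l]
  congr 1
  funext i j k l
  exact hodgeDual_hodgeDual (hW.antisymm_right i j) k l

/-! ### The pointwise consequences of `δW^± = 0` on a soliton -/

section Pointwise

variable {τ : ℝ}

/-- The component of the divergence of the Weyl tensor of a soliton in an orthonormal frame whose
first vector is `∇f/|∇f|`, divided by `|∇f|`. -/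
def flatDivergence (T : Fin 4 → Fin 4 → Fin 4 → Fin 4 → ℝ) (c a b : Fin 4) : ℝ :=
  1 / 2 * T a b 0 c - 1 / 6 * (flatRicci T a 0 * (1 : Matrix (Fin 4) (Fin 4) ℝ) c b
    - flatRicci T b 0 * (1 : Matrix (Fin 4) (Fin 4) ℝ) c a)

/-- The gradient is an eigenvector of the Ricci tensor: the simple two-form `Ric(∇f) ∧ ∇f` has a
vanishing (anti-)self-dual part, so it vanishes. -/
theorem flatRicci_zero_of_divergence (hT : IsCurvatureLike T)
    (h : ∀ c a b, flatDivergence T c a b + τ * hodgeDual (flatDivergence T c) a b = 0)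
    {a : Fin 4} (ha : a ≠ 0) : flatRicci T a 0 = 0 := by
  have tz : ∀ a b, T a b 0 0 = 0 := fun a b => by linarith [hT.antisymm_right a b 0 0]
  have h1 := h 0 0 1
  have h2 := h 0 0 2
  have h3 := h 0 0 3
  simp [hodgeDual, flatDivergence, tz] at h1 h2 h3
  fin_cases a
  · exact absurd rfl ha
  · exact h1
  · exact h2
  · exact h3

/-- In a frame of eigenvectors of the Ricci tensor, the equation with indices `b, 0, d` determines the
component `W^±_{0b0d}`: the curvature terms of both are `T_{0b0d}` and its Hodge dual. -/
theorem flatWeyl_half_of_divergence (hT : IsCurvatureLike T)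
    (h : ∀ c a b, flatDivergence T c a b + τ * hodgeDual (flatDivergence T c) a b = 0)
    (hdiag : ∀ a b, a ≠ b → flatRicci T a b = 0) (b d : Fin 4) (hb : b ≠ 0) (hd : d ≠ 0) :
    1 / 2 * (flatWeyl T 0 b 0 d + τ * hodgeDual (flatWeyl T 0 b) 0 d)
      = -(1 / 12) * (flatRicci T 0 0 + 3 * flatRicci T b b - flatScalar T)
        * (1 : Matrix (Fin 4) (Fin 4) ℝ) b d := by
  have hP := hT.pair_symm
  have e01 := hdiag 0 1 (by decide)
  have e02 := hdiag 0 2 (by decide)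
  have e03 := hdiag 0 3 (by decide)
  have e12 := hdiag 1 2 (by decide)
  have e13 := hdiag 1 3 (by decide)
  have e23 := hdiag 2 3 (by decide)
  have e10 := hdiag 1 0 (by decide)
  have e20 := hdiag 2 0 (by decide)
  have e30 := hdiag 3 0 (by decide)
  have e21 := hdiag 2 1 (by decide)
  have e31 := hdiag 3 1 (by decide)
  have e32 := hdiag 3 2 (by decide)
  have key := h b 0 d
  fin_cases b <;> first | exact absurd rfl hb | skip
  all_goals fin_cases d <;> first | exact absurd rfl hd | skip
  all_goals
    simp [hodgeDual, flatDivergence, flatWeyl, Matrix.one_apply, e01, e02, e03, e12, e13, e23, e10,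
      e20, e30, e21, e31, e32, hP 0 2 0 1, hP 0 3 0 1, hP 0 3 0 2, hP 2 3 0 1, hP 2 3 0 2, hP 2 3 0 3,
      hP 3 1 0 1, hP 3 1 0 2, hP 3 1 0 3, hP 1 2 0 1, hP 1 2 0 2, hP 1 2 0 3] at key ⊢
    linarith

end Pointwise

end

/-! ### Components of tensors in an orthonormal frame -/

section

variable {G : E4 → Matrix (Fin 4) (Fin 4) ℝ} {U : Set E4} {y : E4} {s : E4 → ℝ}

/-- The components of a tensor in the frame whose vectors are the columns of `E`. -/
def frameTensor (E : Matrix (Fin 4) (Fin 4) ℝ) (T : Fin 4 → Fin 4 → Fin 4 → Fin 4 → ℝ)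
    (a b c d : Fin 4) : ℝ :=
  ∑ i, ∑ j, ∑ k, ∑ l, T i j k l * E i a * E j b * E k c * E l d

theorem pairMat_frameTensor (E : Matrix (Fin 4) (Fin 4) ℝ)
    (T : Fin 4 → Fin 4 → Fin 4 → Fin 4 → ℝ) :
    pairMat (frameTensor E T) = (E ⊗ₖ E)ᵀ * pairMat T * (E ⊗ₖ E) := by
  ext ⟨a, b⟩ ⟨c, d⟩
  simp only [pairMat, frameTensor, Matrix.mul_apply, Fintype.sum_prod_type,
    Matrix.transpose_apply, Matrix.kroneckerMap_apply, Matrix.of_apply, Finset.sum_mul]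
  calc _ = ∑ i, ∑ k, ∑ j, ∑ l, T i j k l * E i a * E j b * E k c * E l d :=
        Finset.sum_congr rfl fun i _ => Finset.sum_comm
    _ = ∑ k, ∑ i, ∑ l, ∑ j, T i j k l * E i a * E j b * E k c * E l d := by
        rw [Finset.sum_comm]
        exact Finset.sum_congr rfl fun k _ => Finset.sum_congr rfl fun i _ => Finset.sum_comm
    _ = ∑ k, ∑ l, ∑ i, ∑ j, T i j k l * E i a * E j b * E k c * E l d :=
        Finset.sum_congr rfl fun k _ => Finset.sum_comm
    _ = _ := Finset.sum_congr rfl fun k _ => Finset.sum_congr rfl fun l _ =>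
          Finset.sum_congr rfl fun i _ => Finset.sum_congr rfl fun j _ => by ring

theorem frameTensor_isCurvatureLike {T : Fin 4 → Fin 4 → Fin 4 → Fin 4 → ℝ}
    (hT : IsCurvatureLike T) (E : Matrix (Fin 4) (Fin 4) ℝ) :
    IsCurvatureLike (frameTensor E T) where
  antisymm_left a b c d := by
    rw [frameTensor, Finset.sum_comm, frameTensor, ← Finset.sum_neg_distrib]
    refine Finset.sum_congr rfl fun i _ => ?_
    rw [← Finset.sum_neg_distrib]
    refine Finset.sum_congr rfl fun j _ => ?_
    rw [← Finset.sum_neg_distrib]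
    refine Finset.sum_congr rfl fun k _ => ?_
    rw [← Finset.sum_neg_distrib]
    refine Finset.sum_congr rfl fun l _ => ?_
    rw [hT.antisymm_left i j k l]
    ring
  antisymm_right a b c d := by
    rw [frameTensor, frameTensor, ← Finset.sum_neg_distrib]
    refine Finset.sum_congr rfl fun i _ => ?_
    rw [← Finset.sum_neg_distrib]
    refine Finset.sum_congr rfl fun j _ => ?_
    rw [Finset.sum_comm, ← Finset.sum_neg_distrib]
    refine Finset.sum_congr rfl fun k _ => ?_
    rw [← Finset.sum_neg_distrib]
    refine Finset.sum_congr rfl fun l _ => ?_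
    rw [hT.antisymm_right i j k l]
    ring
  bianchi a b c d := by
    have h1 : frameTensor E T b c a d
        = ∑ i, ∑ j, ∑ k, ∑ l, T j k i l * E j b * E k c * E i a * E l d := by
      rw [frameTensor]
      symm
      rw [Finset.sum_comm]
      exact Finset.sum_congr rfl fun j _ => Finset.sum_comm
    have h2 : frameTensor E T c a b d
        = ∑ i, ∑ j, ∑ k, ∑ l, T k i j l * E k c * E i a * E j b * E l d := by
      rw [frameTensor, Finset.sum_comm]
      exact Finset.sum_congr rfl fun i _ => Finset.sum_comm
    rw [h1, h2, frameTensor]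
    simp only [← Finset.sum_add_distrib]
    refine Finset.sum_eq_zero fun i _ => Finset.sum_eq_zero fun j _ =>
      Finset.sum_eq_zero fun k _ => Finset.sum_eq_zero fun l _ => ?_
    linear_combination E i a * E j b * E k c * E l d * hT.bianchi i j k l

/-- The divergence of a tensor, with its last two indices paired. -/
def divMat (G : E4 → Matrix (Fin 4) (Fin 4) ℝ) (T : Tensor4) (y : E4) :
    Matrix (Fin 4) (Fin 4 × Fin 4) ℝ :=
  Matrix.of fun j q => divergence G T y j q.1 q.2

section Frame

variable {E : Matrix (Fin 4) (Fin 4) ℝ}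

/-- The product of a chart sign with the orientation character of an orthonormal frame. -/
def frameSign (G : E4 → Matrix (Fin 4) (Fin 4) ℝ) (s : E4 → ℝ) (E : Matrix (Fin 4) (Fin 4) ℝ)
    (y : E4) : ℝ :=
  s y * Real.sqrt (G y).det * E.det

theorem mul_transpose_eq_inv (hE : Eᵀ * G y * E = 1) : E * Eᵀ = (G y)⁻¹ := by
  have h : E * (Eᵀ * G y) = 1 := mul_eq_one_comm.1 hE
  exact (Matrix.inv_eq_left_inv (by rw [Matrix.mul_assoc, h])).symm

theorem starMat_frame (hE : Eᵀ * G y * E = 1) :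
    (E ⊗ₖ E)ᵀ * starMat G s y = frameSign G s E y • (flatStar * (E ⊗ₖ E)ᵀ) := by
  have h : (G y)⁻¹ ⊗ₖ (G y)⁻¹ = (E ⊗ₖ E) * (E ⊗ₖ E)ᵀ := by
    rw [← Matrix.kroneckerMap_transpose, ← Matrix.mul_kronecker_mul, mul_transpose_eq_inv hE]
  rw [starMat, h, Matrix.mul_smul, ← Matrix.mul_assoc, ← Matrix.mul_assoc,
    kronecker_mul_leviMat, flatStar, frameSign]
  simp only [Matrix.smul_mul, smul_smul]
  congr 1
  ring

theorem starMat_transpose_frame (hE : Eᵀ * G y * E = 1) :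
    (starMat G s y)ᵀ * (E ⊗ₖ E) = frameSign G s E y • ((E ⊗ₖ E) * flatStar) := by
  have h := congrArg Matrix.transpose (starMat_frame (s := s) hE)
  rwa [Matrix.transpose_mul, Matrix.transpose_transpose, Matrix.transpose_smul,
    Matrix.transpose_mul, Matrix.transpose_transpose, flatStar_transpose] at h

/-- Four-index tensors are determined by their components in a frame. -/
theorem eq_of_frame_eq (hE : Eᵀ * G y * E = 1) {X Y : Matrix (Fin 4 × Fin 4) (Fin 4 × Fin 4) ℝ}
    (h : (E ⊗ₖ E)ᵀ * X * (E ⊗ₖ E) = (E ⊗ₖ E)ᵀ * Y * (E ⊗ₖ E)) : X = Y := by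
  have h1 : (E ⊗ₖ E) * ((Eᵀ * G y) ⊗ₖ (Eᵀ * G y)) = 1 := by
    rw [← Matrix.mul_kronecker_mul, mul_eq_one_comm.1 hE, Matrix.one_kronecker_one]
  have h2 := congrArg Matrix.transpose h1
  rw [Matrix.transpose_mul, Matrix.transpose_one] at h2
  have h3 := congrArg (fun Z => ((Eᵀ * G y) ⊗ₖ (Eᵀ * G y))ᵀ * Z * ((Eᵀ * G y) ⊗ₖ (Eᵀ * G y))) h
  simp only [Matrix.mul_assoc, h1, Matrix.mul_one] at h3
  simpa only [← Matrix.mul_assoc, h2, Matrix.one_mul] using h3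

namespace IsMetricOn

theorem frameSign_sq (hG : IsMetricOn G U) (hs : IsLocalSign s U) (hy : y ∈ U)
    (hE : Eᵀ * G y * E = 1) : frameSign G s E y ^ 2 = 1 := by
  have h := congrArg Matrix.det hE
  rw [Matrix.det_mul, Matrix.det_mul, Matrix.det_transpose, Matrix.det_one] at h
  rw [frameSign, mul_pow, mul_pow, hs.sq_eq_one, Real.sq_sqrt (hG.det_pos hy).le]
  linear_combination h

end IsMetricOn

theorem flatRicci_frameTensor (hE : Eᵀ * G y * E = 1) (a c : Fin 4) :
    flatRicci (frameTensor E (riemann G y)) a c = (Eᵀ * ricciMat G y * E) a c := by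
  have h : ∀ j l, (G y)⁻¹ j l = ∑ b, E j b * E l b := by
    intro j l
    rw [← mul_transpose_eq_inv hE, Matrix.mul_apply]
    rfl
  simp only [flatRicci, frameTensor, Matrix.mul_apply, Matrix.transpose_apply, ricciMat,
    Matrix.of_apply, ricci, h, Finset.sum_mul, Finset.mul_sum]
  calc ∑ b, ∑ i, ∑ j, ∑ k, ∑ l, riemann G y i j k l * E i a * E j b * E k c * E l b
      = ∑ i, ∑ k, ∑ j, ∑ l, ∑ b, riemann G y i j k l * E i a * E j b * E k c * E l b := by
        rw [Finset.sum_comm]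
        refine Finset.sum_congr rfl fun i _ => ?_
        rw [Finset.sum_comm]
        symm
        rw [Finset.sum_comm]
        refine Finset.sum_congr rfl fun j _ => ?_
        symm
        rw [Finset.sum_comm]
        exact Finset.sum_congr rfl fun k _ => Finset.sum_comm
    _ = ∑ k, ∑ i, ∑ j, ∑ l, ∑ b, riemann G y i j k l * E i a * E j b * E k c * E l b :=
        Finset.sum_comm
    _ = _ := Finset.sum_congr rfl fun k _ => Finset.sum_congr rfl fun i _ =>
        Finset.sum_congr rfl fun j _ => Finset.sum_congr rfl fun l _ =>
          Finset.sum_congr rfl fun b _ => by ring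

theorem trace_mul_frame (hE : Eᵀ * G y * E = 1) (S : Matrix (Fin 4) (Fin 4) ℝ) :
    ∑ i, ∑ j, (G y)⁻¹ i j * S i j = (Eᵀ * S * E).trace := by
  rw [sum_mul_eq_trace, ← mul_transpose_eq_inv hE, ← Matrix.trace_transpose,
    Matrix.trace_mul_comm (Eᵀ * S) E, ← Matrix.mul_assoc]
  simp only [Matrix.transpose_mul, Matrix.transpose_transpose]
  rw [Matrix.trace_mul_comm]

theorem flatScalar_frameTensor (hE : Eᵀ * G y * E = 1) :
    flatScalar (frameTensor E (riemann G y)) = scalar G y := by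
  have h : scalar G y = _ := trace_mul_frame hE (ricciMat G y)
  rw [h]
  simp only [flatScalar, flatRicci_frameTensor hE, Matrix.trace, Matrix.diag]

theorem frameTensor_weyl (hE : Eᵀ * G y * E = 1) :
    frameTensor E (weyl G y) = flatWeyl (frameTensor E (riemann G y)) := by
  have hR : ∀ a c, flatRicci (frameTensor E (riemann G y)) a c
      = ∑ i, ∑ k, ricci G y i k * E i a * E k c := by
    intro a c
    rw [flatRicci_frameTensor hE, Finset.sum_comm]
    simp only [Matrix.mul_apply, Matrix.transpose_apply, ricciMat, Matrix.of_apply,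
      Finset.sum_mul]
    exact Finset.sum_congr rfl fun k _ => Finset.sum_congr rfl fun i _ => by ring
  have hg : ∀ a c, (1 : Matrix (Fin 4) (Fin 4) ℝ) a c = ∑ i, ∑ k, G y i k * E i a * E k c := by
    intro a c
    rw [← hE, Finset.sum_comm]
    simp only [Matrix.mul_apply, Matrix.transpose_apply, Finset.sum_mul]
    exact Finset.sum_congr rfl fun k _ => Finset.sum_congr rfl fun i _ => by ring
  have hprod : ∀ (P Q : Matrix (Fin 4) (Fin 4) ℝ) (a b c d : Fin 4),
      ∑ i, ∑ j, ∑ k, ∑ l, P i k * Q j l * E i a * E j b * E k c * E l d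
        = (∑ i, ∑ k, P i k * E i a * E k c) * ∑ j, ∑ l, Q j l * E j b * E l d := by
    intro P Q a b c d
    rw [Finset.sum_mul]
    refine Finset.sum_congr rfl fun i _ => ?_
    rw [Finset.sum_comm, Finset.sum_mul]
    refine Finset.sum_congr rfl fun k _ => ?_
    rw [Finset.mul_sum]
    refine Finset.sum_congr rfl fun j _ => ?_
    rw [Finset.mul_sum]
    exact Finset.sum_congr rfl fun l _ => by ring
  have hprod' : ∀ (P Q : Matrix (Fin 4) (Fin 4) ℝ) (a b c d : Fin 4),
      ∑ i, ∑ j, ∑ k, ∑ l, P i l * Q j k * E i a * E j b * E k c * E l d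
        = (∑ i, ∑ k, P i k * E i a * E k d) * ∑ j, ∑ l, Q j l * E j b * E l c := by
    intro P Q a b c d
    rw [← hprod]
    refine Finset.sum_congr rfl fun i _ => Finset.sum_congr rfl fun j _ => ?_
    rw [Finset.sum_comm]
    exact Finset.sum_congr rfl fun k _ => Finset.sum_congr rfl fun l _ => by ring
  funext a b c d
  have e : ∀ i j k l, weyl G y i j k l * E i a * E j b * E k c * E l d
      = riemann G y i j k l * E i a * E j b * E k c * E l d
        - 1 / 2 * (ricciMat G y i k * G y j l * E i a * E j b * E k c * E l d)
        - 1 / 2 * (G y i k * ricciMat G y j l * E i a * E j b * E k c * E l d)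
        + 1 / 2 * (ricciMat G y i l * G y j k * E i a * E j b * E k c * E l d)
        + 1 / 2 * (G y i l * ricciMat G y j k * E i a * E j b * E k c * E l d)
        + scalar G y / 6 * (G y i k * G y j l * E i a * E j b * E k c * E l d)
        - scalar G y / 6 * (G y i l * G y j k * E i a * E j b * E k c * E l d) := by
    intro i j k l
    simp only [weyl, ricciMat, Matrix.of_apply]
    ring
  rw [frameTensor]
  simp only [e, Finset.sum_add_distrib, Finset.sum_sub_distrib, ← Finset.mul_sum]
  rw [hprod (ricciMat G y) (G y), hprod (G y) (ricciMat G y), hprod' (ricciMat G y) (G y),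
    hprod' (G y) (ricciMat G y), hprod (G y) (G y), hprod' (G y) (G y), flatWeyl,
    flatScalar_frameTensor hE, frameTensor]
  simp only [hR, hg, ricciMat, Matrix.of_apply]
  ring

namespace IsMetricOn

theorem starMat_mul_weyl (hG : IsMetricOn G U) (hy : y ∈ U) (hE : Eᵀ * G y * E = 1) :
    starMat G s y * pairMat (weyl G y) = pairMat (weyl G y) * (starMat G s y)ᵀ := by
  have hR := frameTensor_isCurvatureLike (hG.riemann_isCurvatureLike hy) E
  refine eq_of_frame_eq hE ?_
  have h := flatStar_mul_flatWeyl hR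
  rw [← frameTensor_weyl hE, pairMat_frameTensor] at h
  rw [← Matrix.mul_assoc, starMat_frame hE, Matrix.mul_assoc, Matrix.mul_assoc,
    Matrix.mul_assoc, starMat_transpose_frame hE]
  simp only [Matrix.smul_mul, Matrix.mul_smul, Matrix.mul_assoc] at h ⊢
  rw [h]

theorem starMat_mul_weyl_mul_starMat (hG : IsMetricOn G U) (hs : IsLocalSign s U) (hy : y ∈ U)
    (hE : Eᵀ * G y * E = 1) :
    starMat G s y * (pairMat (weyl G y) * (starMat G s y)ᵀ) = pairMat (weyl G y) := by
  have hR := frameTensor_isCurvatureLike (hG.riemann_isCurvatureLike hy) E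
  refine eq_of_frame_eq hE ?_
  have h := flatStar_mul_flatWeyl_mul_flatStar hR
  rw [← frameTensor_weyl hE, pairMat_frameTensor] at h
  have hsq := hG.frameSign_sq hs hy hE
  rw [← Matrix.mul_assoc, starMat_frame hE, Matrix.mul_assoc, Matrix.mul_assoc,
    Matrix.mul_assoc, starMat_transpose_frame hE]
  simp only [Matrix.smul_mul, Matrix.mul_smul, Matrix.mul_assoc, smul_smul, ← pow_two, hsq,
    one_smul] at h ⊢
  rw [h]

/-- The (anti-)self-dual part of the Weyl tensor is `½ (W ± W⋆)`. -/
theorem pairMat_dualPart_weyl (hG : IsMetricOn G U) (hs : IsLocalSign s U) (hy : y ∈ U)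
    (hE : Eᵀ * G y * E = 1) (ε : ℤˣ) :
    pairMat (dualPart G s ε (weyl G) y) = (1 / 2 : ℝ) • (pairMat (weyl G y)
      + ((ε : ℤ) : ℝ) • (pairMat (weyl G y) * (starMat G s y)ᵀ)) := by
  rw [pairMat_dualPart, hG.starMat_mul_weyl_mul_starMat hs hy hE, hG.starMat_mul_weyl hy hE]
  module

/-- In an orthonormal frame the (anti-)self-dual part of the Weyl tensor is
`½ (W_{abcd} ± W_{abc'd'})`. -/
theorem frameTensor_dualPart_weyl (hG : IsMetricOn G U) (hs : IsLocalSign s U) (hy : y ∈ U)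
    (hE : Eᵀ * G y * E = 1) (ε : ℤˣ) (a b c d : Fin 4) :
    frameTensor E (dualPart G s ε (weyl G) y) a b c d
      = 1 / 2 * (flatWeyl (frameTensor E (riemann G y)) a b c d
        + ((ε : ℤ) : ℝ) * frameSign G s E y
          * hodgeDual (flatWeyl (frameTensor E (riemann G y)) a b) c d) := by
  have hW := flatWeyl_isCurvatureLike
    (frameTensor_isCurvatureLike (hG.riemann_isCurvatureLike hy) E)
  have h : pairMat (frameTensor E (dualPart G s ε (weyl G) y))
      = (1 / 2 : ℝ) • (pairMat (flatWeyl (frameTensor E (riemann G y)))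
        + (((ε : ℤ) : ℝ) * frameSign G s E y) •
          pairMat fun a b => hodgeDual (flatWeyl (frameTensor E (riemann G y)) a b)) := by
    rw [← pairMat_mul_flatStar hW.antisymm_right, ← frameTensor_weyl hE, pairMat_frameTensor,
      pairMat_frameTensor, hG.pairMat_dualPart_weyl hs hy hE]
    simp only [Matrix.smul_mul, Matrix.mul_smul, Matrix.mul_add, Matrix.add_mul,
      Matrix.mul_assoc, starMat_transpose_frame hE, smul_smul]
  exact congrFun (congrFun h (a, b)) (c, d)

theorem smooth_weyl (hG : IsMetricOn G U) (hy : y ∈ U) :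
    SmoothMatAt (fun z => pairMat (weyl G z)) y := by
  rintro ⟨i, j⟩ ⟨k, l⟩
  have hg := hG.smooth y hy
  have hr := hG.smooth_ricci hy
  exact ((hG.smooth_riemann hy i j k l).sub (contDiffAt_const.mul
    (((((hr i k).mul (hg j l)).add ((hr j l).mul (hg i k))).sub ((hr i l).mul (hg j k))).sub
      ((hr j k).mul (hg i l))))).add (((hG.smooth_scalar hy).div_const _).mul
        (((hg i k).mul (hg j l)).sub ((hg i l).mul (hg j k))))

/-- As the Hodge star is parallel, the divergence of `W^±` is `½ (δW ± (δW)⋆)`. -/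
theorem divMat_dualPart_weyl (hG : IsMetricOn G U) (hs : IsLocalSign s U) (hy : y ∈ U)
    (hE : ∀ z ∈ U, ∃ E : Matrix (Fin 4) (Fin 4) ℝ, Eᵀ * G z * E = 1) (ε : ℤˣ) :
    divMat G (dualPart G s ε (weyl G)) y = (1 / 2 : ℝ) • (divMat G (weyl G) y
      + ((ε : ℤ) : ℝ) • (divMat G (weyl G) y * (starMat G s y)ᵀ)) := by
  have hW := hG.smooth_weyl hy
  have hS := hG.smooth_starMat hs hy
  have hWS : SmoothMatAt (fun z => pairMat (starRight G s (weyl G) z)) y := by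
    simp only [pairMat_starRight]
    exact hW.mul hS.transpose
  have hcov : ∀ m, pairMat (covDeriv G (dualPart G s ε (weyl G)) y m)
      = (1 / 2 : ℝ) • (pairMat (covDeriv G (weyl G) y m)
        + ((ε : ℤ) : ℝ) • (pairMat (covDeriv G (weyl G) y m) * (starMat G s y)ᵀ)) := by
    intro m
    have hnear : (fun z => pairMat (dualPart G s ε (weyl G) z)) =ᶠ[𝓝 y] fun z =>
        (1 / 2 : ℝ) • (pairMat (weyl G z)
          + ((ε : ℤ) : ℝ) • pairMat (starRight G s (weyl G) z)) := by
      filter_upwards [hG.mem_nhds hy] with z hz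
      obtain ⟨E, hE⟩ := hE z hz
      rw [hG.pairMat_dualPart_weyl hs hz hE, pairMat_starRight]
    have h0 : pairMat (dualPart G s ε (weyl G) y) = (1 / 2 : ℝ) • (pairMat (weyl G y)
        + ((ε : ℤ) : ℝ) • pairMat (starRight G s (weyl G) y)) := hnear.self_of_nhds
    have hd : pdMat m (fun z => pairMat (dualPart G s ε (weyl G) z)) y
        = (1 / 2 : ℝ) • (pdMat m (fun z => pairMat (weyl G z)) y
          + ((ε : ℤ) : ℝ) • pdMat m (fun z => pairMat (starRight G s (weyl G) z)) y) := by
      rw [pdMat_congr hnear]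
      ext p q
      have h1 := hW.diff p q
      have h2 := hWS.diff p q
      simp only [pdMat, Matrix.of_apply, Matrix.smul_apply, Matrix.add_apply, smul_eq_mul]
      rw [pd_const_mul (h1.fun_add ((differentiableAt_const _).fun_mul h2)),
        pd_add h1 ((differentiableAt_const _).fun_mul h2), pd_const_mul h2]
    rw [← hG.covDeriv_starRight hs hy hW, pairMat_covDeriv, pairMat_covDeriv, pairMat_covDeriv,
      hd, h0]
    simp only [Matrix.mul_smul, Matrix.smul_mul, Matrix.mul_add, Matrix.add_mul]
    module
  ext j ⟨k, l⟩
  have hcov' : ∀ m i, covDeriv G (dualPart G s ε (weyl G)) y m i j k l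
      = 1 / 2 * (covDeriv G (weyl G) y m i j k l + ((ε : ℤ) : ℝ)
        * ∑ q : Fin 4 × Fin 4, covDeriv G (weyl G) y m i j q.1 q.2 * starMat G s y (k, l) q) :=
    fun m i => congrFun (congrFun (hcov m) (i, j)) (k, l)
  simp only [divMat, Matrix.of_apply, Matrix.smul_apply, Matrix.add_apply, Matrix.mul_apply,
    Matrix.transpose_apply, smul_eq_mul, divergence, hcov', Finset.sum_mul]
  have hswap : ∑ q : Fin 4 × Fin 4, ∑ m, ∑ i, (G y)⁻¹ m i
        * covDeriv G (weyl G) y m i j q.1 q.2 * starMat G s y (k, l) q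
      = ∑ m, ∑ i, (G y)⁻¹ m i
        * ∑ q : Fin 4 × Fin 4, covDeriv G (weyl G) y m i j q.1 q.2 * starMat G s y (k, l) q := by
    rw [Finset.sum_comm]
    refine Finset.sum_congr rfl fun m _ => ?_
    rw [Finset.sum_comm]
    refine Finset.sum_congr rfl fun i _ => ?_
    rw [Finset.mul_sum]
    exact Finset.sum_congr rfl fun q _ => by ring
  rw [hswap]
  simp only [Finset.mul_sum, ← Finset.sum_add_distrib]
  exact Finset.sum_congr rfl fun m _ => Finset.sum_congr rfl fun i _ => by
    simp only [← Finset.mul_sum]; ring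

/-- The vanishing of `δW^±` on a soliton, in an orthonormal frame that starts with `∇f/|∇f|`. -/
theorem flatDivergence_add_hodgeDual (hG : IsMetricOn G U) (hs : IsLocalSign s U) (hy : y ∈ U)
    (hframe : ∀ z ∈ U, ∃ E : Matrix (Fin 4) (Fin 4) ℝ, Eᵀ * G z * E = 1) {ε : ℤˣ} {F : E4 → ℝ}
    {lam n : ℝ} (hF : ContDiffAt ℝ ∞ F y)
    (hsol : ∀ z ∈ U, ∀ i j, ricci G z i j + hessian G F z i j = lam * G z i j)
    (hdiv : ∀ j k l, divergence G (dualPart G s ε (weyl G)) y j k l = 0)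
    (hE : Eᵀ * G y * E = 1) (hn : n ≠ 0) (hv : ∀ h, pd h F y = ∑ a, G y h a * (n * E a 0))
    (c a b : Fin 4) :
    flatDivergence (frameTensor E (riemann G y)) c a b + ((ε : ℤ) : ℝ) * frameSign G s E y
      * hodgeDual (flatDivergence (frameTensor E (riemann G y)) c) a b = 0 := by
  set R := frameTensor E (riemann G y) with hRdef
  have hRc : IsCurvatureLike R :=
    frameTensor_isCurvatureLike (hG.riemann_isCurvatureLike hy) E
  have h0 : divMat G (weyl G) y
      + ((ε : ℤ) : ℝ) • (divMat G (weyl G) y * (starMat G s y)ᵀ) = 0 := by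
    have h := hG.divMat_dualPart_weyl hs hy hframe ε
    have hz : divMat G (dualPart G s ε (weyl G)) y = 0 := by
      ext j q
      exact hdiv j q.1 q.2
    rw [hz] at h
    exact (smul_eq_zero_iff_right (by norm_num)).1 h.symm
  have hX : ∀ c a b, (Eᵀ * divMat G (weyl G) y * (E ⊗ₖ E)) c (a, b)
      = n * flatDivergence R c a b := by
    intro c a b
    have hr : ∀ a, n * flatRicci R a 0
        = ∑ k, (∑ m, ricci G y k m * (n * E m 0)) * E k a := by
      intro a
      rw [flatRicci_frameTensor hE, Matrix.mul_assoc, Matrix.mul_apply, Finset.mul_sum]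
      refine Finset.sum_congr rfl fun k _ => ?_
      rw [Matrix.mul_apply, Matrix.transpose_apply, Finset.mul_sum, Finset.mul_sum,
        Finset.sum_mul]
      exact Finset.sum_congr rfl fun m _ => by simp only [ricciMat, Matrix.of_apply]; ring
    have hg : ∀ c b, (1 : Matrix (Fin 4) (Fin 4) ℝ) c b = ∑ l, ∑ j, G y j l * E j c * E l b := by
      intro c b
      rw [← hE]
      simp only [Matrix.mul_apply, Matrix.transpose_apply, Finset.sum_mul]
      exact Finset.sum_congr rfl fun l _ => Finset.sum_congr rfl fun j _ => by ring
    have hT : n * R a b 0 c = ∑ k, ∑ l, ∑ j, (∑ m, riemann G y k l m j * (n * E m 0))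
        * E j c * E k a * E l b := by
      rw [hRdef, frameTensor, Finset.mul_sum]
      refine Finset.sum_congr rfl fun k _ => ?_
      rw [Finset.mul_sum]
      refine Finset.sum_congr rfl fun l _ => ?_
      rw [Finset.sum_comm, Finset.mul_sum]
      refine Finset.sum_congr rfl fun j _ => ?_
      simp only [Finset.mul_sum, Finset.sum_mul]
      exact Finset.sum_congr rfl fun m _ => by ring
    have h1 : n * flatRicci R a 0 * (1 : Matrix (Fin 4) (Fin 4) ℝ) c b
        = ∑ k, ∑ l, ∑ j, (∑ m, ricci G y k m * (n * E m 0)) * G y j l * E j c * E k a * E l b := by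
      rw [hr, hg, Finset.sum_mul]
      refine Finset.sum_congr rfl fun k _ => ?_
      rw [Finset.mul_sum]
      refine Finset.sum_congr rfl fun l _ => ?_
      rw [Finset.mul_sum]
      exact Finset.sum_congr rfl fun j _ => by ring
    have h2 : n * flatRicci R b 0 * (1 : Matrix (Fin 4) (Fin 4) ℝ) c a
        = ∑ k, ∑ l, ∑ j, (∑ m, ricci G y l m * (n * E m 0)) * G y j k * E j c * E k a * E l b := by
      rw [hr, hg, Finset.mul_sum]
      refine Finset.sum_congr rfl fun k _ => ?_
      rw [Finset.sum_mul]
      refine Finset.sum_congr rfl fun l _ => ?_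
      rw [Finset.mul_sum]
      exact Finset.sum_congr rfl fun j _ => by ring
    have h3 : n * flatDivergence R c a b = 1 / 2 * (n * R a b 0 c)
        - 1 / 6 * (n * flatRicci R a 0 * (1 : Matrix (Fin 4) (Fin 4) ℝ) c b)
        + 1 / 6 * (n * flatRicci R b 0 * (1 : Matrix (Fin 4) (Fin 4) ℝ) c a) := by
      rw [flatDivergence]; ring
    rw [h3, hT, h1, h2]
    simp only [Finset.mul_sum, ← Finset.sum_add_distrib, ← Finset.sum_sub_distrib]
    rw [Matrix.mul_apply, Fintype.sum_prod_type]
    refine Finset.sum_congr rfl fun k _ => Finset.sum_congr rfl fun l _ => ?_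
    rw [Matrix.mul_apply, Finset.sum_mul]
    refine Finset.sum_congr rfl fun j _ => ?_
    rw [divMat, Matrix.of_apply, hG.divergence_weyl_of_soliton hy hF hsol hv]
    simp only [Matrix.transpose_apply, Matrix.kroneckerMap_apply]
    ring
  have hXa : ∀ i j, (Eᵀ * divMat G (weyl G) y * (E ⊗ₖ E)) c (j, i)
      = -(Eᵀ * divMat G (weyl G) y * (E ⊗ₖ E)) c (i, j) := by
    intro i j
    rw [hX, hX, flatDivergence, flatDivergence, hRc.antisymm_left i j]
    ring
  have h4 := congrArg (fun Z => Eᵀ * Z * (E ⊗ₖ E)) h0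
  simp only [Matrix.mul_add, Matrix.add_mul, Matrix.mul_smul, Matrix.smul_mul, Matrix.mul_zero,
    Matrix.zero_mul, Matrix.mul_assoc, starMat_transpose_frame hE, smul_smul] at h4
  simp only [← Matrix.mul_assoc] at h4
  have h5 := congrFun (congrFun h4 c) (a, b)
  rw [Matrix.add_apply, Matrix.smul_apply, mul_flatStar_apply hXa, smul_eq_mul, Matrix.zero_apply]
    at h5
  simp only [hX] at h5
  have h6 : hodgeDual (fun i j => n * flatDivergence R c i j) a b
      = n * hodgeDual (flatDivergence R c) a b := by
    fin_cases a <;> fin_cases b <;> simp [hodgeDual]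
  rw [h6] at h5
  refine (mul_eq_zero_iff_left hn).1 ?_
  linear_combination h5

end IsMetricOn

end Frame

end

/-! ### Orthonormal frames of eigenvectors -/

section

/-- A symmetric operator on a four-dimensional Euclidean space with a given unit eigenvector `w` has
an orthonormal eigenbasis that starts with `w`. -/
theorem exists_orthonormal_eigenbasis {V : Type*} [NormedAddCommGroup V] [InnerProductSpace ℝ V]
    [FiniteDimensional ℝ V] (hV : Module.finrank ℝ V = 4) {A : V →ₗ[ℝ] V} (hA : A.IsSymmetric)
    {w : V} (hw : ‖w‖ = 1) {μ : ℝ} (hAw : A w = μ • w) :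
    ∃ (b : Fin 4 → V) (a : Fin 4 → ℝ), Orthonormal ℝ b ∧ b 0 = w ∧ ∀ i, A (b i) = a i • b i := by
  have hw0 : w ≠ 0 := fun h => by simp [h] at hw
  have hinv : ∀ x ∈ (ℝ ∙ w)ᗮ, A x ∈ (ℝ ∙ w)ᗮ := by
    intro x hx
    rw [Submodule.mem_orthogonal_singleton_iff_inner_right] at hx ⊢
    rw [← hA w x, hAw, inner_smul_left, hx, mul_zero]
  have hA' := hA.restrict_invariant hinv
  have hfin : Module.finrank ℝ (ℝ ∙ w)ᗮ = 3 := by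
    have := Submodule.finrank_add_finrank_orthogonal (ℝ ∙ w)
    rw [finrank_span_singleton hw0, hV] at this
    omega
  let b' := hA'.eigenvectorBasis hfin
  refine ⟨Fin.cons w fun i => (b' i : V), Fin.cons μ (hA'.eigenvalues hfin), ?_, rfl, ?_⟩
  · have hperp : ∀ i, inner ℝ w (b' i : V) = 0 := fun i =>
      (Submodule.mem_orthogonal_singleton_iff_inner_right).1 (b' i).2
    rw [orthonormal_iff_ite]
    intro i j
    refine Fin.cases ?_ (fun i => ?_) i <;> refine Fin.cases ?_ (fun j => ?_) j
    · simp [hw]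
    · simpa [(Fin.succ_ne_zero j).symm] using hperp j
    · simpa [real_inner_comm] using hperp i
    · have := orthonormal_iff_ite.1 b'.orthonormal i j
      simpa [Submodule.coe_inner] using this
  · intro i
    refine Fin.cases ?_ (fun i => ?_) i
    · simpa using hAw
    · have := congrArg Subtype.val (hA'.apply_eigenvectorBasis hfin i)
      exact this

/-- A positive definite `G` and a symmetric `S` are simultaneously diagonalized by a frame that is
orthonormal for `G` and starts with a given `G`-unit vector `v` with `S v = μ G v`. -/
theorem exists_frame_diagonalizing {G S : Matrix (Fin 4) (Fin 4) ℝ} (hG : G.PosDef) (hS : Sᵀ = S)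
    {v : Fin 4 → ℝ} (hv : v ⬝ᵥ G *ᵥ v = 1) {μ : ℝ} (hSv : S *ᵥ v = μ • G *ᵥ v) :
    ∃ (E : Matrix (Fin 4) (Fin 4) ℝ) (a : Fin 4 → ℝ),
      Eᵀ * G * E = 1 ∧ (∀ i, E i 0 = v i) ∧ Eᵀ * S * E = Matrix.diagonal a := by
  obtain ⟨B, hB, hGB⟩ : ∃ B : Matrix (Fin 4) (Fin 4) ℝ, IsUnit B ∧ G = Bᵀ * B := by
    open scoped MatrixOrder Matrix.Norms.L2Operator in
    obtain ⟨B, hB, h⟩ := CStarAlgebra.isStrictlyPositive_iff_eq_star_mul_self.mp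
      hG.isStrictlyPositive
    exact ⟨B, hB, h⟩
  have hBdet : IsUnit B.det := (Matrix.isUnit_iff_isUnit_det B).1 hB
  have hBi : B * B⁻¹ = 1 := Matrix.mul_nonsing_inv _ hBdet
  have hiB : B⁻¹ * B = 1 := Matrix.nonsing_inv_mul _ hBdet
  have hBiT : (B⁻¹)ᵀ * Bᵀ = 1 := by rw [← Matrix.transpose_mul, hBi, Matrix.transpose_one]
  let S₁ := (B⁻¹)ᵀ * S * B⁻¹
  have hS₁ : S₁.IsHermitian := by
    simp [S₁, Matrix.IsHermitian, Matrix.conjTranspose_eq_transpose_of_trivial, hS,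
      Matrix.mul_assoc]
  have hA : (Matrix.toEuclideanLin S₁).IsSymmetric := Matrix.isSymmetric_toEuclideanLin_iff.2 hS₁
  let w : EuclideanSpace ℝ (Fin 4) := WithLp.toLp 2 (B *ᵥ v)
  have hw : ‖w‖ = 1 := by
    have : ‖w‖ ^ 2 = 1 := by
      rw [← real_inner_self_eq_norm_sq, ← hv, hGB]
      simp only [w, EuclideanSpace.inner_toLp_toLp, star_trivial]
      rw [← Matrix.mulVec_mulVec, Matrix.dotProduct_mulVec v, Matrix.vecMul_transpose]
    nlinarith [norm_nonneg w]
  have hAw : Matrix.toEuclideanLin S₁ w = μ • w := by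
    have : S₁ *ᵥ (B *ᵥ v) = μ • (B *ᵥ v) := by
      simp only [S₁]
      rw [Matrix.mulVec_mulVec, Matrix.mul_assoc, hiB, Matrix.mul_one, ← Matrix.mulVec_mulVec, hSv,
        hGB, Matrix.mulVec_smul, Matrix.mulVec_mulVec, ← Matrix.mul_assoc, hBiT, Matrix.one_mul]
    simp only [w, Matrix.toLpLin_toLp, Matrix.toLin'_apply, this]
    rfl
  obtain ⟨b, a, hb, hb0, hba⟩ := exists_orthonormal_eigenbasis (by simp) hA hw hAw
  let O : Matrix (Fin 4) (Fin 4) ℝ := Matrix.of fun i j => b j i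
  have hO : Oᵀ * O = 1 := by
    ext i j
    have := orthonormal_iff_ite.1 hb i j
    rw [Matrix.one_apply, ← this]
    simp [Matrix.mul_apply, O, PiLp.inner_apply, mul_comm]
  have hSO : S₁ * O = O * Matrix.diagonal a := by
    ext i j
    have := congrArg (fun x : EuclideanSpace ℝ (Fin 4) => x i) (hba j)
    rw [Matrix.mul_diagonal]
    simpa [Matrix.toLpLin_apply, Matrix.mulVec, dotProduct, Matrix.mul_apply, O, mul_comm]
      using this
  refine ⟨B⁻¹ * O, a, ?_, fun i => ?_, ?_⟩
  · rw [hGB, Matrix.transpose_mul]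
    calc Oᵀ * (B⁻¹)ᵀ * (Bᵀ * B) * (B⁻¹ * O) = Oᵀ * ((B⁻¹)ᵀ * Bᵀ) * (B * B⁻¹) * O := by
          simp only [Matrix.mul_assoc]
      _ = 1 := by rw [hBiT, hBi, Matrix.mul_one, Matrix.mul_one, hO]
  · have : (B⁻¹ * O) i 0 = (B⁻¹ *ᵥ (B *ᵥ v)) i := by
      have hcol : ∀ k, O k 0 = (B *ᵥ v) k := fun k => by simp [O, hb0, w]
      simp only [Matrix.mul_apply, hcol]
      rfl
    rw [this, Matrix.mulVec_mulVec, hiB, Matrix.one_mulVec]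
  · rw [Matrix.transpose_mul]
    calc Oᵀ * (B⁻¹)ᵀ * S * (B⁻¹ * O) = Oᵀ * (S₁ * O) := by simp only [S₁, Matrix.mul_assoc]
      _ = Matrix.diagonal a := by rw [hSO, ← Matrix.mul_assoc, hO, Matrix.one_mul]

theorem exists_frame {G : Matrix (Fin 4) (Fin 4) ℝ} (hG : G.PosDef) {v : Fin 4 → ℝ}
    (hv : v ⬝ᵥ G *ᵥ v = 1) :
    ∃ E : Matrix (Fin 4) (Fin 4) ℝ, Eᵀ * G * E = 1 ∧ ∀ i, E i 0 = v i := by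
  obtain ⟨E, -, h1, h2, -⟩ := exists_frame_diagonalizing (S := 0) hG (by simp) hv (μ := 0)
    (by simp)
  exact ⟨E, h1, h2⟩

end

/-! ### Tensor components in charts -/

section

variable {M : Type*} [TopologicalSpace M] [ChartedSpace E4 M] {φ : OpenPartialHomeomorph M E4}

/-- The derivative of the inverse of a chart expands a vector of `E4` in the coordinate frame. -/
theorem mfderiv_symm_eq_sum (φ : OpenPartialHomeomorph M E4) (y x : E4) :
    (mfderiv (𝓡 4) (𝓡 4) φ.symm y : E4 →L[ℝ] TangentSpace (𝓡 4) (φ.symm y)) x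
      = ∑ i, x i • coordFrame φ y i := by
  have key : ∀ {V : Type} [AddCommGroup V] [Module ℝ V] [TopologicalSpace V] (D : E4 →L[ℝ] V),
      D x = ∑ i, x i • D (EuclideanSpace.single i (1 : ℝ)) := by
    intro V _ _ _ D
    have hx : x = ∑ i, x i • EuclideanSpace.single i (1 : ℝ) := by
      ext j
      simp [Finset.sum_apply, Pi.single_apply]
    conv_lhs => rw [hx]
    simp only [map_sum, map_smul]
  exact key _

theorem isLocalSign_chartSign (o : ManifoldOrientation M) (hφ : φ ∈ atlas E4 M) :
    IsLocalSign (chartSign o φ) φ.target where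
  eventuallyEq y hy := by
    filter_upwards [o.locallyConstant φ hφ y hy] with z hz
    rw [chartSign, chartSign]
    by_cases h : IsPositiveFrame (o.toFun (φ.symm y)) (coordFrame φ y)
    · rw [if_pos (hz.2 h), if_pos h]
    · rw [if_neg (mt hz.1 h), if_neg h]
  sq_eq_one y := by
    rw [chartSign]
    split_ifs <;> norm_num

variable [IsManifold (𝓡 4) ∞ M] {g : Metric4 M} {f : M → ℝ} {p : M}

theorem contMDiffAt_symm_of_mem_atlas (hφ : φ ∈ atlas E4 M) {y : E4} (hy : y ∈ φ.target) :
    ContMDiffAt (𝓡 4) (𝓡 4) ∞ φ.symm y :=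
  ((contMDiffOn_symm_of_mem_maximalAtlas
    (IsManifold.subset_maximalAtlas (I := 𝓡 4) (n := ∞) hφ)) y hy).contMDiffAt
      (φ.open_target.mem_nhds hy)

theorem chart_mdifferentiable (hφ : φ ∈ atlas E4 M) : φ.MDifferentiable (𝓡 4) (𝓡 4) :=
  have : IsManifold (𝓡 4) 1 M := IsManifold.of_le (n := ∞) (by simp)
  mdifferentiable_of_mem_atlas hφ

theorem contMDiffAt_coordFrame (hφ : φ ∈ atlas E4 M) {y : E4} (hy : y ∈ φ.target) (i : Fin 4) :
    ContMDiffAt (𝓡 4) (𝓡 4).tangent ∞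
      (fun z => (⟨φ.symm z, coordFrame φ z i⟩ : TangentBundle (𝓡 4) M)) y := by
  have : IsManifold (𝓡 4) 1 M := IsManifold.of_le (n := ∞) (by simp)
  have h := contMDiffAt_symm_of_mem_atlas hφ hy
  have hc : ContMDiffAt (𝓡 4) (𝓡 4).tangent ∞
      (fun z : E4 => (⟨z, EuclideanSpace.single i (1 : ℝ)⟩ : TangentBundle (𝓡 4) E4)) y :=
    contMDiffAt_vectorSpace_iff_contDiffAt.2 contDiffAt_const
  exact ContMDiffAt.clm_apply_of_inCoordinates (h.mfderiv_const (m := ∞) le_rfl) hc h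

theorem smooth_metricComponents (g : Metric4 M) (hφ : φ ∈ atlas E4 M) {y : E4}
    (hy : y ∈ φ.target) : SmoothMatAt (metricComponents g φ) y := by
  intro i j
  have h := contMDiffAt_symm_of_mem_atlas hφ hy
  have hg := (g.contMDiff (φ.symm y)).comp y h
  have := ContMDiffAt.clm_bundle_apply₂ (F₁ := E4) (F₂ := E4) (F₃ := ℝ)
    (E₁ := fun x : M => TangentSpace (𝓡 4) x) (E₂ := fun x : M => TangentSpace (𝓡 4) x)
    (E₃ := Bundle.Trivial M ℝ) (b := φ.symm) (ψ := fun z => g.inner (φ.symm z))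
    (v := fun z => coordFrame φ z i) (w := fun z => coordFrame φ z j) hg
    (contMDiffAt_coordFrame hφ hy i) (contMDiffAt_coordFrame hφ hy j)
  rw [Bundle.contMDiffAt_totalSpace] at this
  exact this.2.contDiffAt

theorem inner_mfderiv_symm (g : Metric4 M) (φ : OpenPartialHomeomorph M E4) (y x z : E4) :
    g.inner (φ.symm y)
      ((mfderiv (𝓡 4) (𝓡 4) φ.symm y : E4 →L[ℝ] TangentSpace (𝓡 4) (φ.symm y)) x)
      ((mfderiv (𝓡 4) (𝓡 4) φ.symm y : E4 →L[ℝ] TangentSpace (𝓡 4) (φ.symm y)) z)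
      = ∑ i, ∑ j, metricComponents g φ y i j * x i * z j := by
  rw [mfderiv_symm_eq_sum, mfderiv_symm_eq_sum]
  simp only [map_sum, map_smul, FunLike.coe_sum, Finset.sum_apply, _root_.smul_apply,
    smul_eq_mul, metricComponents, Matrix.of_apply, Finset.mul_sum]
  rw [Finset.sum_comm]
  exact Finset.sum_congr rfl fun i _ => Finset.sum_congr rfl fun j _ => by ring

theorem isMetricOn_metricComponents (g : Metric4 M) (hφ : φ ∈ atlas E4 M) :
    IsMetricOn (metricComponents g φ) φ.target where
  isOpen := φ.open_target
  symm y := by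
    ext i j
    exact g.symm _ _ _
  smooth y hy := smooth_metricComponents g hφ hy
  posDef y hy := by
    refine Matrix.PosDef.of_dotProduct_mulVec_pos ?_ fun x hx => ?_
    · ext i j
      simp only [Matrix.conjTranspose_apply, star_trivial]
      exact g.symm _ _ _
    · set D : E4 →L[ℝ] TangentSpace (𝓡 4) (φ.symm y) := mfderiv (𝓡 4) (𝓡 4) φ.symm y
      have hD : D (WithLp.toLp 2 x) ≠ 0 := by
        intro h0
        have h := (chart_mdifferentiable hφ).comp_symm_deriv hy
        have h1 := congrArg (fun A : E4 →L[ℝ] E4 => A (WithLp.toLp 2 x)) h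
        have h2 : (mfderiv (𝓡 4) (𝓡 4) φ (φ.symm y) : TangentSpace (𝓡 4) (φ.symm y) →L[ℝ] E4)
          (D (WithLp.toLp 2 x)) = WithLp.toLp 2 x := h1
        rw [h0, map_zero] at h2
        exact hx (congrArg WithLp.ofLp h2.symm)
      have h := (g.pos _ _ hD).trans_eq
        (inner_mfderiv_symm g φ y (WithLp.toLp 2 x) (WithLp.toLp 2 x))
      have e : star x ⬝ᵥ (metricComponents g φ y *ᵥ x)
          = ∑ i, ∑ j, metricComponents g φ y i j * x i * x j := by
        simp only [star_trivial, dotProduct, Matrix.mulVec, Finset.mul_sum]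
        exact Finset.sum_congr rfl fun i _ => Finset.sum_congr rfl fun j _ => by ring
      rw [e]
      exact h

theorem contDiffAt_comp_symm (hf : ContMDiff (𝓡 4) 𝓘(ℝ) ∞ f) (hφ : φ ∈ atlas E4 M) {y : E4}
    (hy : y ∈ φ.target) : ContDiffAt ℝ ∞ (f ∘ φ.symm) y :=
  ((hf (φ.symm y)).comp y (contMDiffAt_symm_of_mem_atlas hφ hy)).contDiffAt

/-- The metric on tangent vectors at `p`, in terms of their components in a chart. -/
theorem inner_eq_sum_coords (g : Metric4 M) (hφ : φ ∈ atlas E4 M) (hp : p ∈ φ.source)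
    (u w : TangentSpace (𝓡 4) p) :
    g.inner p u w
      = ∑ i, ∑ j, metricComponents g φ (φ p) i j * coords φ p u i * coords φ p w j := by
  rw [← inner_mfderiv_symm]
  have h := (chart_mdifferentiable hφ).symm_comp_deriv hp
  have hu : ∀ u : E4, (mfderiv (𝓡 4) (𝓡 4) φ.symm (φ p) : E4 →L[ℝ] E4) (coords φ p u) = u :=
    fun u => congrArg (fun A : E4 →L[ℝ] E4 => A u) h
  -- `φ.symm (φ p)` is `p` only propositionally; with all tangent spaces unfolded to `E4`, the base
  -- point can be rewritten.
  let gi : M → E4 → E4 → ℝ := fun x u w => g.inner x u w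
  have hgi : gi (φ.symm (φ p)) = gi p := by rw [φ.left_inv hp]
  change gi p u w = gi (φ.symm (φ p)) _ _
  rw [hgi]
  exact (congrArg₂ (gi p) (hu u) (hu w)).symm

/-- Every vector of `E4` is the component vector of a tangent vector. -/
theorem exists_coords_eq (hφ : φ ∈ atlas E4 M) (hp : p ∈ φ.source) (x : E4) :
    ∃ u : TangentSpace (𝓡 4) p, coords φ p u = x := by
  have h := (chart_mdifferentiable hφ).comp_symm_deriv (φ.map_source hp)
  -- The tangent spaces are unfolded to `E4` so that the base point `φ.symm (φ p)` can be rewritten.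
  let D : M → E4 → E4 := fun q => (mfderiv (𝓡 4) (𝓡 4) φ q : E4 →L[ℝ] E4)
  have hD : D (φ.symm (φ p)) = D p := by rw [φ.left_inv hp]
  have h2 : D (φ.symm (φ p)) ((mfderiv (𝓡 4) (𝓡 4) φ.symm (φ p) : E4 →L[ℝ] E4) x) = x :=
    congrArg (fun A : E4 →L[ℝ] E4 => A x) h
  rw [hD] at h2
  exact ⟨_, h2⟩

theorem grad_spec (g : Metric4 M) (f : M → ℝ) (p : M) (u : TangentSpace (𝓡 4) p) :
    g.inner p (grad g f p) u = mfderiv (𝓡 4) 𝓘(ℝ) f p u :=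
  (exists_gradient g f p).choose_spec u

/-- The gradient is the differential with its index raised. -/
theorem pd_comp_symm (hf : ContMDiff (𝓡 4) 𝓘(ℝ) ∞ f) (hφ : φ ∈ atlas E4 M) (hp : p ∈ φ.source)
    (h : Fin 4) : pd h (f ∘ φ.symm) (φ p)
      = ∑ a, metricComponents g φ (φ p) h a * coords φ p (grad g f p) a := by
  obtain ⟨u, hu⟩ := exists_coords_eq hφ hp (EuclideanSpace.single h (1 : ℝ))
  have h1 : pd h (f ∘ φ.symm) (φ p) = mfderiv (𝓡 4) 𝓘(ℝ) f p u := by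
    have hd : MDifferentiableAt (𝓡 4) 𝓘(ℝ) f p := (hf p).mdifferentiableAt (by simp)
    have hs : MDifferentiableAt (𝓡 4) (𝓡 4) φ.symm (φ p) :=
      (contMDiffAt_symm_of_mem_atlas hφ (φ.map_source hp)).mdifferentiableAt (by simp)
    have hF : MDifferentiableAt (𝓡 4) 𝓘(ℝ) (f ∘ φ.symm) (φ p) :=
      MDifferentiableAt.comp (φ p) (by rw [φ.left_inv hp]; exact hd) hs
    have e : f =ᶠ[𝓝 p] (f ∘ φ.symm) ∘ φ := by
      filter_upwards [φ.open_source.mem_nhds hp] with q hq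
      simp [φ.left_inv hq]
    rw [e.mfderiv_eq, mfderiv_comp p hF ((chart_mdifferentiable hφ).mdifferentiableAt hp),
      mfderiv_eq_fderiv]
    change _ = fderiv ℝ (f ∘ φ.symm) (φ p) (coords φ p u)
    rw [hu]
    rfl
  rw [h1, ← grad_spec g, g.symm, inner_eq_sum_coords g hφ hp, hu]
  simp

/-! ### Adapted frames -/

/-- The matrix whose columns are the components of the vectors `e` in the chart `φ`. -/
def frameMat (φ : OpenPartialHomeomorph M E4) (p : M) (e : Fin 4 → TangentSpace (𝓡 4) p) :
    Matrix (Fin 4) (Fin 4) ℝ :=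
  Matrix.of fun i a => coords φ p (e a) i

/-- The matrix of the traceless Ricci tensor in the chart `φ`. -/
def tracelessMat (g : Metric4 M) (φ : OpenPartialHomeomorph M E4) (p : M) :
    Matrix (Fin 4) (Fin 4) ℝ :=
  Matrix.of (tracelessRicci (metricComponents g φ) (φ p))

theorem sum_mul_mul_eq (S E : Matrix (Fin 4) (Fin 4) ℝ) (a b : Fin 4) :
    (Eᵀ * S * E) a b = ∑ i, ∑ j, S i j * E i a * E j b := by
  rw [Finset.sum_comm]
  simp only [Matrix.mul_apply, Matrix.transpose_apply, Finset.sum_mul]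
  exact Finset.sum_congr rfl fun j _ => Finset.sum_congr rfl fun i _ => by ring

theorem frameMat_orthonormal (g : Metric4 M) (hφ : φ ∈ atlas E4 M) (hp : p ∈ φ.source)
    {e : Fin 4 → TangentSpace (𝓡 4) p} :
    (frameMat φ p e)ᵀ * metricComponents g φ (φ p) * frameMat φ p e = 1
      ↔ ∀ i j, g.inner p (e i) (e j) = if i = j then 1 else 0 := by
  have h : ∀ i j, ((frameMat φ p e)ᵀ * metricComponents g φ (φ p) * frameMat φ p e) i j
      = g.inner p (e i) (e j) := fun i j => by
    rw [sum_mul_mul_eq, inner_eq_sum_coords g hφ hp]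
    rfl
  rw [← Matrix.ext_iff]
  simp only [h, Matrix.one_apply]

theorem tracelessMat_eq (g : Metric4 M) (φ : OpenPartialHomeomorph M E4) (p : M) :
    tracelessMat g φ p = ricciMat (metricComponents g φ) (φ p)
      - (scalar (metricComponents g φ) (φ p) / 4) • metricComponents g φ (φ p) := rfl

theorem gradientNorm_ne_zero {g : Metric4 M} (h : grad g f p ≠ 0) : gradientNorm g f p ≠ 0 :=
  (Real.sqrt_pos.2 (g.pos p _ h)).ne'

/-- An orthonormal frame that starts with `∇f/|∇f|` satisfies the pointwise equation expressing
`δW^± = 0`; here `τ` is the product of the sign `ε` with the orientation of the frame. -/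
theorem flatDivergence_add_hodgeDual_eq_zero {o : ManifoldOrientation M} {ε : ℤˣ}
    (hsol : IsGradientRicciSoliton g f) (hW : IsHalfWeylHarmonic g o ε) (hgrad : grad g f p ≠ 0)
    (hφ : φ ∈ atlas E4 M) (hp : p ∈ φ.source) {E : Matrix (Fin 4) (Fin 4) ℝ}
    (hE : Eᵀ * metricComponents g φ (φ p) * E = 1)
    (hE0 : ∀ i, coords φ p (grad g f p) i = gradientNorm g f p * E i 0) (c a b : Fin 4) :
    flatDivergence (frameTensor E (riemann (metricComponents g φ) (φ p))) c a b
      + ((ε : ℤ) : ℝ) * frameSign (metricComponents g φ) (chartSign o φ) E (φ p)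
        * hodgeDual (flatDivergence (frameTensor E (riemann (metricComponents g φ) (φ p))) c) a b
      = 0 := by
  obtain ⟨hf, lam, hlam⟩ := hsol
  have hy := φ.map_source hp
  have hG := isMetricOn_metricComponents g hφ
  refine hG.flatDivergence_add_hodgeDual (isLocalSign_chartSign o hφ) hy (fun z hz => ?_)
    (contDiffAt_comp_symm hf hφ hy) (hlam φ hφ) (hW φ hφ (φ p) hy) hE
    (gradientNorm_ne_zero hgrad) (fun h => ?_) c a b
  · have hpd := hG.posDef z hz
    have h00 : 0 < metricComponents g φ z 0 0 := hpd.diag_pos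
    -- Any unit vector can start an orthonormal frame at `z`, for instance the normalized `∂₁`.
    obtain ⟨E, hE, -⟩ := exists_frame hpd
      (v := Pi.single 0 (Real.sqrt (metricComponents g φ z 0 0))⁻¹) (by
        rw [Matrix.mulVec_single, single_dotProduct]
        simp only [Pi.smul_apply, Matrix.col_apply, MulOpposite.smul_eq_mul_unop,
          MulOpposite.unop_op]
        have h1 := Real.mul_self_sqrt h00.le
        have h2 := (Real.sqrt_pos.2 h00).ne'
        field_simp
        nlinarith)
    exact ⟨E, hE⟩
  · rw [pd_comp_symm (g := g) hf hφ hp]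
    simp only [hE0]

/-- The operator `S` in an orthonormal frame for `G`, by `G * E * Eᵀ = 1`. -/
theorem mul_frame_eq {G E : Matrix (Fin 4) (Fin 4) ℝ} (hE : Eᵀ * G * E = 1)
    (S : Matrix (Fin 4) (Fin 4) ℝ) : S * E = G * E * (Eᵀ * S * E) := by
  rw [Matrix.mul_assoc] at hE
  rw [← Matrix.mul_assoc, ← Matrix.mul_assoc, mul_eq_one_comm.1 hE, Matrix.one_mul]

/-- Existence of the eigenbases: `∇f` is an eigenvector of the traceless Ricci tensor, so the first
vector `∇f/|∇f|` can be completed. -/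
theorem exists_isAdaptedEigenbasis {o : ManifoldOrientation M} {ε : ℤˣ}
    (hsol : IsGradientRicciSoliton g f) (hW : IsHalfWeylHarmonic g o ε) (hgrad : grad g f p ≠ 0)
    (hφ : φ ∈ atlas E4 M) (hp : p ∈ φ.source) :
    ∃ (e : Fin 4 → TangentSpace (𝓡 4) p) (a : Fin 4 → ℝ), IsAdaptedEigenbasis g f φ p e a := by
  have hy := φ.map_source hp
  have hG := isMetricOn_metricComponents g hφ
  set G := metricComponents g φ (φ p) with hGdef
  have hn := gradientNorm_ne_zero hgrad
  let v : Fin 4 → ℝ := fun i => (gradientNorm g f p)⁻¹ * coords φ p (grad g f p) i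
  have hv : v ⬝ᵥ G *ᵥ v = 1 := by
    have h1 : gradientNorm g f p ^ 2 = _ :=
      (Real.sq_sqrt (g.pos p _ hgrad).le).trans (inner_eq_sum_coords g hφ hp _ _)
    have h2 : v ⬝ᵥ G *ᵥ v = (gradientNorm g f p)⁻¹ ^ 2 * gradientNorm g f p ^ 2 := by
      rw [h1]
      simp only [dotProduct, Matrix.mulVec, Finset.mul_sum, v]
      exact Finset.sum_congr rfl fun i _ => Finset.sum_congr rfl fun j _ => by ring
    rw [h2, ← mul_pow, inv_mul_cancel₀ hn, one_pow]
  have hgv : ∀ i, coords φ p (grad g f p) i = gradientNorm g f p * v i := fun i => by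
    simp only [v]
    rw [mul_inv_cancel_left₀ hn]
  have hSt : (tracelessMat g φ p)ᵀ = tracelessMat g φ p := by
    rw [tracelessMat_eq, Matrix.transpose_sub, Matrix.transpose_smul, hG.symm]
    congr 1
    ext i j
    exact hG.ricci_symm hy j i
  -- In any frame starting with `∇f/|∇f|` the Ricci tensor has no mixed components with `∇f`.
  obtain ⟨E', hE', hE'0⟩ := exists_frame (hG.posDef _ hy) hv
  have hS0 : ∀ a, a ≠ 0 → (E'ᵀ * tracelessMat g φ p * E') a 0 = 0 := by
    intro a ha
    have h := flatRicci_zero_of_divergence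
      (frameTensor_isCurvatureLike (hG.riemann_isCurvatureLike hy) E')
      (fun c a b => flatDivergence_add_hodgeDual_eq_zero hsol hW hgrad hφ hp hE'
        (fun i => by rw [hE'0, hgv]) c a b) ha
    rw [flatRicci_frameTensor hE'] at h
    rw [tracelessMat_eq, Matrix.mul_sub, Matrix.sub_mul, Matrix.sub_apply, h, Matrix.mul_smul,
      Matrix.smul_mul, hE']
    simp [ha]
  have hSv : tracelessMat g φ p *ᵥ v
      = (E'ᵀ * tracelessMat g φ p * E') 0 0 • G *ᵥ v := by
    funext i
    have hsum : (G * E' * (E'ᵀ * tracelessMat g φ p * E')) i 0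
        = (G * E') i 0 * (E'ᵀ * tracelessMat g φ p * E') 0 0 := by
      rw [Matrix.mul_apply]
      exact Finset.sum_eq_single 0 (fun a _ ha => by rw [hS0 a ha, mul_zero]) (by simp)
    have h := congrFun (congrFun (mul_frame_eq hE' (tracelessMat g φ p)) i) 0
    rw [hsum, Matrix.mul_apply, Matrix.mul_apply] at h
    simp only [hE'0] at h
    rw [Pi.smul_apply, smul_eq_mul, mul_comm]
    exact h
  obtain ⟨E, a, hE, hE0, hES⟩ := exists_frame_diagonalizing (hG.posDef _ hy) hSt hv hSv
  choose e he using fun a => exists_coords_eq hφ hp (WithLp.toLp 2 fun i => E i a)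
  have hEe : frameMat φ p e = E := by
    ext i a
    simp only [frameMat, Matrix.of_apply, he]
  refine ⟨e, a, (frameMat_orthonormal g hφ hp).1 (by rw [hEe]; exact hE), ?_, fun i u => ?_⟩
  · have hinj : Function.Injective (coords φ p) :=
      Function.LeftInverse.injective (g := fun x =>
        (mfderiv (𝓡 4) (𝓡 4) φ.symm (φ p) : E4 →L[ℝ] E4) x) fun u =>
        congrArg (fun A : E4 →L[ℝ] E4 => A u) ((chart_mdifferentiable hφ).symm_comp_deriv hp)
    apply hinj
    have hsm : coords φ p ((gradientNorm g f p)⁻¹ • grad g f p)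
        = (gradientNorm g f p)⁻¹ • coords φ p (grad g f p) :=
      map_smul (mfderiv (𝓡 4) (𝓡 4) φ p) _ _
    rw [hsm, he]
    ext i
    exact hE0 i
  · have hSE := mul_frame_eq hE (tracelessMat g φ p)
    rw [hES] at hSE
    have hj : ∀ j, ∑ k, tracelessRicci (metricComponents g φ) (φ p) k j * E k i
        = a i * ∑ k, G k j * E k i := by
      intro j
      have h := congrFun (congrFun hSE j) i
      rw [Matrix.mul_diagonal, Matrix.mul_apply, Matrix.mul_apply, mul_comm] at h
      have h1 : ∀ k, tracelessMat g φ p j k = tracelessRicci (metricComponents g φ) (φ p) k j :=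
        fun k => (congrFun (congrFun hSt j) k).symm
      have h2 : ∀ k, metricComponents g φ (φ p) j k = metricComponents g φ (φ p) k j := fun k => g.symm _ _ _
      simpa only [h1, h2] using h
    rw [tracelessRicciAt, inner_eq_sum_coords g hφ hp, Finset.sum_comm,
      Finset.sum_comm (f := fun k j => metricComponents g φ (φ p) k j * _ * _), Finset.mul_sum]
    refine Finset.sum_congr rfl fun j _ => ?_
    rw [he, ← Finset.sum_mul, ← Finset.sum_mul, ← mul_assoc]
    exact congrArg (· * coords φ p u j) (hj j)

end

end HalfWeyl

end

open HalfWeyl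
/-- On an oriented four-dimensional gradient Ricci soliton with `δW^± = 0` (one fixed sign `ε`), at
every point where `∇f ≠ 0` there are orthonormal eigenbases of the traceless Ricci tensor that start
with `∇f/|∇f|`, and in each of them `W^±_{1j1l}` has the stated values. The tensors at `p` are
computed in an arbitrary chart `φ` of the atlas around `p`. -/
theorem proposition2p1 {M : Type*} [TopologicalSpace M] [ChartedSpace E4 M]
    [IsManifold (𝓡 4) ∞ M] (g : Metric4 M) (o : ManifoldOrientation M) (f : M → ℝ) (ε : ℤˣ)
    (hsol : IsGradientRicciSoliton g f) (hW : IsHalfWeylHarmonic g o ε)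
    (p : M) (hp : grad g f p ≠ 0)
    (φ : OpenPartialHomeomorph M E4) (hφ : φ ∈ atlas E4 M) (hpφ : p ∈ φ.source) :
    (∃ (e : Fin 4 → TangentSpace (𝓡 4) p) (a : Fin 4 → ℝ), IsAdaptedEigenbasis g f φ p e a) ∧
    ∀ (e : Fin 4 → TangentSpace (𝓡 4) p) (a : Fin 4 → ℝ), IsAdaptedEigenbasis g f φ p e a →
      (halfWeylAt g o ε φ p (e 0) (e 1) (e 0) (e 1) = -(1 / 12) * (a 0 + 3 * a 1) ∧
        -(1 / 12) * (a 0 + 3 * a 1) = (1 / 12) * (a 2 + a 3 - 2 * a 1)) ∧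
      (halfWeylAt g o ε φ p (e 0) (e 2) (e 0) (e 2) = -(1 / 12) * (a 0 + 3 * a 2) ∧
        -(1 / 12) * (a 0 + 3 * a 2) = (1 / 12) * (a 1 + a 3 - 2 * a 2)) ∧
      (halfWeylAt g o ε φ p (e 0) (e 3) (e 0) (e 3) = -(1 / 12) * (a 0 + 3 * a 3) ∧
        -(1 / 12) * (a 0 + 3 * a 3) = (1 / 12) * (a 1 + a 2 - 2 * a 3)) ∧
      ∀ j l : Fin 4, j ≠ l → halfWeylAt g o ε φ p (e 0) (e j) (e 0) (e l) = 0 := by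
  refine ⟨exists_isAdaptedEigenbasis hsol hW hp hφ hpφ, fun e a he => ?_⟩
  have hy := φ.map_source hpφ
  have hG := isMetricOn_metricComponents g hφ
  have hE := (frameMat_orthonormal g hφ hpφ).2 he.orthonormal
  set E := frameMat φ p e with hEdef
  set R := frameTensor E (riemann (metricComponents g φ) (φ p)) with hRdef
  have hR : IsCurvatureLike R := frameTensor_isCurvatureLike (hG.riemann_isCurvatureLike hy) E
  have hWR := flatWeyl_isCurvatureLike hR
  have hn := gradientNorm_ne_zero hp
  have hE0 : ∀ i, coords φ p (grad g f p) i = gradientNorm g f p * E i 0 := by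
    intro i
    have h1 : coords φ p ((gradientNorm g f p)⁻¹ • grad g f p)
        = (gradientNorm g f p)⁻¹ • coords φ p (grad g f p) :=
      map_smul (mfderiv (𝓡 4) (𝓡 4) φ p) _ _
    have h2 : E i 0 = (gradientNorm g f p)⁻¹ * coords φ p (grad g f p) i := by
      change coords φ p (e 0) i = _
      rw [he.first, h1]
      rfl
    rw [h2, mul_inv_cancel_left₀ hn]
  have hdiv := flatDivergence_add_hodgeDual_eq_zero hsol hW hp hφ hpφ hE hE0
  have hric : ∀ i j, flatRicci R i j - flatScalar R / 4 * (if i = j then 1 else 0)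
      = a i * if i = j then 1 else 0 := by
    intro i j
    rw [← he.orthonormal i j, ← he.eigen i (e j), he.orthonormal i j, hRdef,
      flatRicci_frameTensor hE, flatScalar_frameTensor hE]
    have h : tracelessRicciAt g φ p (e i) (e j) = (E.transpose * tracelessMat g φ p * E) i j := by
      rw [sum_mul_mul_eq]
      rfl
    rw [h, tracelessMat_eq, Matrix.mul_sub, Matrix.sub_mul, Matrix.sub_apply, Matrix.mul_smul,
      Matrix.smul_mul, hE, Matrix.smul_apply, smul_eq_mul, Matrix.one_apply]
  have hoff : ∀ i j, i ≠ j → flatRicci R i j = 0 := fun i j hij => by simpa [hij] using hric i j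
  have hdiag : ∀ i, flatRicci R i i = a i + flatScalar R / 4 := fun i => by
    have := hric i i
    simp only [if_true, mul_one] at this
    linarith
  have hsum : a 0 + a 1 + a 2 + a 3 = 0 := by
    have h : flatScalar R = _ := Fin.sum_univ_four fun i => flatRicci R i i
    simp only [hdiag] at h
    linarith
  have hval : ∀ j l : Fin 4, j ≠ 0 → l ≠ 0 → halfWeylAt g o ε φ p (e 0) (e j) (e 0) (e l)
      = -(1 / 12) * (a 0 + 3 * a j) * (1 : Matrix (Fin 4) (Fin 4) ℝ) j l := by
    intro j l hj hl
    have h := hG.frameTensor_dualPart_weyl (isLocalSign_chartSign o hφ) hy hE ε 0 j 0 l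
    rw [flatWeyl_half_of_divergence hR hdiv hoff j l hj hl, hdiag, hdiag] at h
    refine Eq.trans h ?_
    ring
  have hzero : ∀ j l : Fin 4, j = 0 ∨ l = 0 →
      halfWeylAt g o ε φ p (e 0) (e j) (e 0) (e l) = 0 := by
    intro j l hjl
    have h := hG.frameTensor_dualPart_weyl (isLocalSign_chartSign o hφ) hy hE ε 0 j 0 l
    refine Eq.trans h ?_
    have hz : ∀ k l, flatWeyl R 0 0 k l = 0 := fun k l => by
      linarith [hWR.antisymm_left 0 0 k l]
    have hz' : flatWeyl R 0 j 0 0 = 0 := by linarith [hWR.antisymm_right 0 j 0 0]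
    rcases hjl with rfl | rfl
    · have h0 : flatWeyl R 0 0 = fun _ _ => 0 := funext fun k => funext (hz k)
      rw [h0]
      fin_cases l <;> simp [hodgeDual]
    · rw [← hRdef, hz']
      fin_cases j <;> simp [hodgeDual]
  refine ⟨⟨?_, by linarith⟩, ⟨?_, by linarith⟩, ⟨?_, by linarith⟩, fun j l hjl => ?_⟩
  · rw [hval 1 1 (by decide) (by decide), Matrix.one_apply_eq, mul_one]
  · rw [hval 2 2 (by decide) (by decide), Matrix.one_apply_eq, mul_one]
  · rw [hval 3 3 (by decide) (by decide), Matrix.one_apply_eq, mul_one]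
  · by_cases h : j = 0 ∨ l = 0
    · exact hzero j l h
    · rw [not_or] at h
      rw [hval j l h.1 h.2, Matrix.one_apply_ne hjl, mul_zero]
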